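/- Let $q \ge 1$ be an integer and let $\chi_q$ be a primitive Dirichlet character modulo $q$ which is real (all its values are real numbers) and odd, i.e. $\chi_q(-1) = -1$. Let $L(s,\chi_q)$ be the Dirichlet $L$-function of $\chi_q$, i.e. the entire function that equals $\sum_{n=1}^{\infty} \chi_q(n) n^{-s}$ for $\operatorname{Re} s > 1$. Then the series $\sum_{n=1}^{\infty} \frac{\chi_q(n)}{n}$ converges (as the limit of its partial sums), with $$\sum_{n=1}^{\infty} \frac{\chi_q(n)}{n} = L(1,\chi_q),$$ and $$\sum_{k=1}^{q-1} \chi_q(k) \left(\frac{k}{q}\right)^2 = -\frac{\sqrt{q}}{\pi}\, L(1,\chi_q).$$ -/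

import Mathlib

open Filter Topology

/-!
The proof evaluates the quadratic Gauss sum `τ = ∑ χ(a) e(a/q)` with its sign, `τ = i √q`, and then
reads off both sides of the identity from the values of `log (1 - e(k/q))`.

*The Gauss sum.* The relation `χ(-1) * conj τ = τ` only gives the argument of `τ` up to sign; the
sign comes from the Landsberg–Schaar relation (`sum_exp_sq_eq`), obtained by letting `δ → 0⁺` in
Jacobi's transformation of `∑ exp (-π z n²)` at `z = (δ + i m / (2c))⁻¹`. It evaluates
`∑ e(c n² / m)` over residues modulo `m`. For odd `m` and a real primitive `χ` modulo `m`, the Gauss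
sum of `χ` equals `∑ ψ(n²)` for *every* primitive additive character `ψ`
(`gaussSum_eq_sum_sq_of_odd`): both sides are multiplicative under the Chinese remainder theorem,
for a prime modulus `n² = a` has `1 + χ(a)` solutions, and there is no real primitive character
modulo a higher power of an odd prime. Hence `τ` is known for odd `q`. For even `q` primitivity
forces `q = 4 m` or `q = 8 m` with `m` odd, and the Chinese remainder theorem reduces `τ` to a sum
over residues modulo `4` or `8` and to `∑ e(n² / m)` or `∑ e(2 n² / m)`
(`DirichletCharacter.gaussSum_eq_I_mul_sqrt`).

*The series.* Expanding `χ(n) = τ⁻¹ ∑ χ(k) e(nk/q)` and using `∑ zⁿ/n = -log (1 - z)` on the unit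
circle, `∑ χ(n)/n = -τ⁻¹ ∑ χ(k) log (1 - e(k/q))`. As `χ` is odd, only the odd part of the logarithm
contributes, namely `π i (k/q - 1/2)`, so `∑ χ(n)/n = -(π/√q) ∑ χ(k) k/q`. The symmetry `k ↦ q - k`
turns `∑ χ(k) k/q` into `∑ χ(k) (k/q)²`.

*The value at `1`.* The partial sums of `χ` are bounded, so both `L(1, χ)` and the limit of the
partial sums of `∑ χ(n)/n` equal `∫ S(t) t⁻² dt` over `t > 1`, where `S(t) = ∑ χ(n)` over `n ≤ t`.
-/

/-! ### Gaussian sums and the Landsberg–Schaar relation -/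

open Complex in
theorem ofReal_mul_cpow_of_pos {r : ℝ} (hr : 0 < r) {z : ℂ} (hz : z ≠ 0) (s : ℂ) :
    ((r : ℂ) * z) ^ s = (r : ℂ) ^ s * z ^ s := by
  have hr0 : (r : ℂ) ≠ 0 := by exact_mod_cast hr.ne'
  rw [cpow_def_of_ne_zero (mul_ne_zero hr0 hz), cpow_def_of_ne_zero hr0, cpow_def_of_ne_zero hz,
    log_ofReal_mul hr hz, ← Complex.exp_add, ofReal_log hr.le, add_mul]

open Complex in
theorem ofReal_cpow_half {r : ℝ} (hr : 0 ≤ r) : (r : ℂ) ^ (1 / 2 : ℂ) = (Real.sqrt r : ℂ) := by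
  rw [show (1 / 2 : ℂ) = ((1 / 2 : ℝ) : ℂ) by norm_num, ← ofReal_cpow hr, ← Real.sqrt_eq_rpow]

open Complex in
/-- Poisson summation for a Gaussian along an arithmetic progression. -/
theorem tsum_exp_neg_mul_arith_prog_sq {w : ℂ} (hw : 0 < w.re) {N : ℕ} (hN : 0 < N) (r : ℤ) :
    w ^ (1 / 2 : ℂ) * ∑' k : ℤ, cexp (-Real.pi * w * ((N * k + r : ℤ) : ℂ) ^ 2) =
      (1 / N) * ∑' k : ℤ, cexp (-Real.pi / (N ^ 2) * w⁻¹ * k ^ 2 +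
        2 * Real.pi * I * (k * r / N)) := by
  have hw0 : w ≠ 0 := by rintro rfl; simp at hw
  have hN0 : (N : ℂ) ≠ 0 := by exact_mod_cast hN.ne'
  have ha : 0 < (((N ^ 2 : ℝ) : ℂ) * w).re := by
    rw [re_ofReal_mul]; positivity
  have key := Complex.tsum_exp_neg_quadratic ha (-N * r * w)
  have hpow : (((N ^ 2 : ℝ) : ℂ) * w) ^ (1 / 2 : ℂ) = N * w ^ (1 / 2 : ℂ) := by
    rw [ofReal_mul_cpow_of_pos (by positivity) hw0, ofReal_cpow_half (by positivity),
      Real.sqrt_sq (by positivity), ofReal_natCast]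
  have hwp : w ^ (1 / 2 : ℂ) ≠ 0 := by simp [cpow_eq_zero_iff, hw0]
  rw [hpow] at key
  calc _ = w ^ (1 / 2 : ℂ) * (cexp (-Real.pi * w * r ^ 2) * ∑' k : ℤ,
        cexp (-Real.pi * (((N ^ 2 : ℝ) : ℂ) * w) * k ^ 2 + 2 * Real.pi * (-N * r * w) * k)) := by
        congr 1
        rw [← tsum_mul_left]
        refine tsum_congr fun k => ?_
        rw [← Complex.exp_add]
        congr 1
        push_cast
        ring
    _ = _ := by
        rw [key, ← tsum_mul_left, ← tsum_mul_left, ← tsum_mul_left, ← tsum_mul_left]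
        refine tsum_congr fun k => ?_
        have : cexp (-Real.pi / (N ^ 2) * w⁻¹ * k ^ 2 + 2 * Real.pi * I * (k * r / N)) =
          cexp (-Real.pi * w * r ^ 2) *
            cexp (-Real.pi / (((N ^ 2 : ℝ) : ℂ) * w) * (k + I * (-N * r * w)) ^ 2) := by
          rw [← Complex.exp_add]
          congr 1
          push_cast
          field_simp
          ring_nf
          simp only [I_sq]
          ring
        rw [this]
        field_simp

open Complex in
/-- As `w → 0` with `Re (1 / w) → ∞`, the Gaussian sum over a residue class modulo `N` is asymptotic
to `w ^ (-1 / 2) / N`: only the zero frequency survives on the dual side. -/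
theorem tendsto_sqrt_mul_tsum_arith_prog {ι : Type*} {l : Filter ι} {w : ι → ℂ}
    (hw : ∀ᶠ i in l, 0 < (w i).re) (hw' : Tendsto (fun i => ((w i)⁻¹).re) l atTop)
    {N : ℕ} (hN : 0 < N) (r : ℤ) :
    Tendsto (fun i => w i ^ (1 / 2 : ℂ) *
      ∑' k : ℤ, cexp (-Real.pi * w i * ((N * k + r : ℤ) : ℂ) ^ 2)) l (𝓝 (1 / N)) := by
  have hlim : Tendsto (fun i => ∑' k : ℤ,
      cexp (-Real.pi / (N ^ 2) * (w i)⁻¹ * k ^ 2 + 2 * Real.pi * I * (k * r / N))) l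
      (𝓝 (∑' k : ℤ, if k = 0 then 1 else 0)) := by
    have hn (i : ι) (k : ℤ) : ‖cexp (-Real.pi / (N ^ 2) * (w i)⁻¹ * k ^ 2 +
        2 * Real.pi * I * (k * r / N))‖ = Real.exp (-(Real.pi / N ^ 2 * k ^ 2 * ((w i)⁻¹).re)) := by
      rw [norm_exp]
      congr 1
      have h1 : (-Real.pi / (N ^ 2) * (w i)⁻¹ * k ^ 2 + 2 * Real.pi * I * (k * r / N) : ℂ) =
        ((-(Real.pi / N ^ 2 * k ^ 2) : ℝ) : ℂ) * (w i)⁻¹ +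
          ((2 * Real.pi * (k * r / N) : ℝ) : ℂ) * I := by
        push_cast; ring
      rw [h1, add_re, re_ofReal_mul, re_ofReal_mul, I_re]
      ring
    refine tendsto_tsum_of_dominated_convergence
      (bound := fun k : ℤ => Real.exp (-(Real.pi / N ^ 2)) ^ k.natAbs) ?_ ?_ ?_
    · have h1 : Summable fun n : ℕ => Real.exp (-(Real.pi / N ^ 2)) ^ n :=
        summable_geometric_of_lt_one (Real.exp_nonneg _)
          (Real.exp_lt_one_iff.mpr (neg_lt_zero.mpr (by positivity)))
      exact Summable.of_nat_of_neg (by simpa using h1) (by simpa using h1)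
    · intro k
      split_ifs with hk
      · subst hk
        simpa using tendsto_const_nhds
      · rw [tendsto_zero_iff_norm_tendsto_zero]
        simp_rw [hn]
        refine Real.tendsto_exp_neg_atTop_nhds_zero.comp (hw'.const_mul_atTop ?_)
        positivity
    · filter_upwards [hw'.eventually_ge_atTop 1] with i hi k
      rw [hn, ← Real.exp_nat_mul, Real.exp_le_exp]
      have h1 : (k.natAbs : ℝ) ≤ (k : ℝ) ^ 2 := by
        rw [← Int.cast_natCast, Int.natCast_natAbs]
        exact_mod_cast (Int.le_self_sq |k|).trans_eq (sq_abs k)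
      have : (k.natAbs : ℝ) * 1 ≤ (k : ℝ) ^ 2 * ((w i)⁻¹).re := by gcongr
      have := mul_le_mul_of_nonneg_left this (by positivity : 0 ≤ Real.pi / N ^ 2)
      linarith
  rw [tsum_ite_eq] at hlim
  have := hlim.const_mul (1 / (N : ℂ))
  rw [mul_one] at this
  refine this.congr' ?_
  filter_upwards [hw] with i hi
  rw [tsum_exp_neg_mul_arith_prog_sq hi hN]


open Complex in
theorem tsum_periodic_mul_exp_neg_sq {w : ℂ} (hw : 0 < w.re) {N : ℕ} (hN : 0 < N) {a : ℤ → ℂ}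
    (ha : ∀ k r : ℤ, a (N * k + r) = a r) :
    ∑' n : ℤ, a n * cexp (-Real.pi * w * (n : ℂ) ^ 2) =
      ∑ r ∈ Finset.range N, a r *
        ∑' k : ℤ, cexp (-Real.pi * w * ((N * k + r : ℤ) : ℂ) ^ 2) := by
  have : NeZero N := ⟨hN.ne'⟩
  have hs : Summable fun n : ℤ => cexp (-Real.pi * w * (n : ℂ) ^ 2) := by
    have h1 : 0 < (I * w).im := by simpa using hw
    refine ((summable_jacobiTheta₂_term_iff 0 (I * w)).mpr h1).congr fun n => ?_
    rw [jacobiTheta₂_term]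
    congr 1
    ring_nf
    simp
  let e := (Int.divModEquiv N)
  have he (p : ℤ × Fin N) : e.symm p = N * p.1 + (p.2 : ℕ) := by
    simp [e, Int.divModEquiv, mul_comm]
  have hbd : Summable fun n : ℤ => a n * cexp (-Real.pi * w * (n : ℂ) ^ 2) := by
    refine Summable.of_norm_bounded (g := fun n : ℤ => (∑ r : Fin N, ‖a (r : ℕ)‖) *
      ‖cexp (-Real.pi * w * (n : ℂ) ^ 2)‖) (hs.norm.mul_left _) fun n => ?_
    rw [norm_mul]
    gcongr
    rw [← e.symm_apply_apply n, he, ha]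
    exact Finset.single_le_sum (f := fun r : Fin N => ‖a (r : ℕ)‖) (fun _ _ => norm_nonneg _)
      (Finset.mem_univ _)
  let e' : Fin N × ℤ ≃ ℤ := (Equiv.prodComm (Fin N) ℤ).trans e.symm
  rw [← e'.tsum_eq]
  have hbd2 := e'.summable_iff.mpr hbd
  rw [Summable.tsum_prod (f := fun p => a (e' p) * cexp (-Real.pi * w * (e' p : ℂ) ^ 2)) hbd2,
    tsum_fintype, Finset.sum_range]
  refine Finset.sum_congr rfl fun r _ => ?_
  rw [← tsum_mul_left]
  refine tsum_congr fun k => ?_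
  have h1 : e' (r, k) = N * k + (r : ℕ) := he (k, r)
  rw [h1, ha]

open Complex in
/-- A Gaussian sum with `N`-periodic coefficients is asymptotic to `w ^ (-1 / 2)` times the mean of
the coefficients. -/
theorem tendsto_sqrt_mul_tsum_periodic {ι : Type*} {l : Filter ι} {w : ι → ℂ}
    (hw : ∀ᶠ i in l, 0 < (w i).re) (hw' : Tendsto (fun i => ((w i)⁻¹).re) l atTop)
    {N : ℕ} (hN : 0 < N) {a : ℤ → ℂ} (ha : ∀ k r : ℤ, a (N * k + r) = a r) :
    Tendsto (fun i => w i ^ (1 / 2 : ℂ) *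
      ∑' n : ℤ, a n * cexp (-Real.pi * w i * (n : ℂ) ^ 2)) l
      (𝓝 ((∑ r ∈ Finset.range N, a r) / N)) := by
  have h : Tendsto (fun i => ∑ r ∈ Finset.range N, a r * (w i ^ (1 / 2 : ℂ) *
      ∑' k : ℤ, cexp (-Real.pi * w i * ((N * k + r : ℤ) : ℂ) ^ 2))) l
      (𝓝 (∑ r ∈ Finset.range N, a r * (1 / N))) :=
    tendsto_finsetSum _ fun r _ => (tendsto_sqrt_mul_tsum_arith_prog hw hw' hN r).const_mul _
  rw [← Finset.sum_mul, mul_one_div] at h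
  refine h.congr' ?_
  filter_upwards [hw] with i hi
  rw [tsum_periodic_mul_exp_neg_sq hi hN ha, Finset.mul_sum]
  exact Finset.sum_congr rfl fun r _ => by ring

open Complex in
/-- The **Landsberg–Schaar relation**: the quadratic Gauss sum `∑ e(c n² / m)` over residues modulo
`m` in terms of a sum over residues modulo `2 * c`. -/
theorem sum_exp_sq_eq {m c : ℕ} (hm : 0 < m) (hc : 0 < c) :
    ∑ r ∈ Finset.range m, cexp (2 * Real.pi * I * (c * (r : ℂ) ^ 2 / m)) =
      (Real.sqrt (m / (2 * c)) : ℂ) * cexp (Real.pi * I / 4) *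
        ∑ r ∈ Finset.range (2 * c), cexp (-Real.pi * I * ((r : ℂ) ^ 2 * m / (2 * c))) := by
  set B : ℝ := m / (2 * c) with hB
  have hB0 : 0 < B := by positivity
  have hBC : (B : ℂ) ≠ 0 := by exact_mod_cast hB0.ne'
  have hmC : (m : ℂ) ≠ 0 := by exact_mod_cast hm.ne'
  have hcC : (c : ℂ) ≠ 0 := by exact_mod_cast hc.ne'
  have hBe : (B : ℂ) = m / (2 * c) := by rw [hB]; push_cast; ring
  -- At `z = (D d)⁻¹` both sides of Jacobi's identity are Gaussian sums with periodic coefficients: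
  -- `z = w - i / B` oscillates with period `m`, and its dual `D d = d + i B` with period `2 * c`.
  let D : ℝ → ℂ := fun d => d + B * I
  have hDre (d : ℝ) : (D d).re = d := by simp [D]
  have hDim (d : ℝ) : (D d).im = B := by simp [D]
  have hD0 (d : ℝ) : D d ≠ 0 := fun h => hB0.ne' (by rw [← hDim d, h, zero_im])
  let w : ℝ → ℂ := fun d => (D d)⁻¹ + I / B
  have hw (d : ℝ) : w d = d * (I / (B * D d)) := by
    have := hD0 d
    simp only [w]
    field_simp
    simp only [D]
    ring_nf
    simp
  have hwinv (d : ℝ) (hd : 0 < d) : (w d)⁻¹ = ((B ^ 2 / d : ℝ) : ℂ) - B * I := by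
    have hdC : (d : ℂ) ≠ 0 := by exact_mod_cast hd.ne'
    have := hD0 d
    rw [hw]
    push_cast
    field_simp
    simp only [D]
    ring_nf
    simp
  have hpos : ∀ᶠ d : ℝ in 𝓝[>] 0, 0 < d := self_mem_nhdsWithin
  have hwre : ∀ᶠ d : ℝ in 𝓝[>] 0, 0 < (w d).re := by
    filter_upwards [hpos] with d hd
    have : 0 < ((w d)⁻¹).re := by
      rw [hwinv d hd, sub_re, ofReal_re, re_ofReal_mul, I_re, mul_zero, sub_zero]
      positivity
    rw [inv_re] at this
    exact pos_of_mul_pos_left this (inv_nonneg.mpr (normSq_nonneg _))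
  have hwlim : Tendsto (fun d => ((w d)⁻¹).re) (𝓝[>] 0) atTop := by
    refine (tendsto_inv_nhdsGT_zero.const_mul_atTop (by positivity : 0 < B ^ 2)).congr' ?_
    filter_upwards [hpos] with d hd
    rw [hwinv d hd, sub_re, ofReal_re, re_ofReal_mul, I_re, mul_zero, sub_zero, div_eq_mul_inv]
  have L1 := tendsto_sqrt_mul_tsum_periodic hwre hwlim hm
    (a := fun n : ℤ => cexp (2 * Real.pi * I * (c * (n : ℂ) ^ 2 / m))) (by
      intro k r
      rw [Complex.exp_eq_exp_iff_exists_int]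
      refine ⟨c * (m * k ^ 2 + 2 * k * r), ?_⟩
      push_cast
      field_simp
      ring)
  have L2 := tendsto_sqrt_mul_tsum_periodic (l := 𝓝[>] (0 : ℝ)) (w := fun d => (d : ℂ))
    (by simpa using hpos)
    (by simpa [← ofReal_inv] using tendsto_inv_nhdsGT_zero) (by positivity : 0 < 2 * c)
    (a := fun n : ℤ => cexp (-Real.pi * I * ((n : ℂ) ^ 2 * m / (2 * c)))) (by
      intro k r
      rw [Complex.exp_eq_exp_iff_exists_int]
      refine ⟨-(m * (c * k ^ 2 + k * r)), ?_⟩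
      push_cast
      field_simp
      ring)
  have heq : ∀ᶠ d : ℝ in 𝓝[>] 0, w d ^ (1 / 2 : ℂ) *
      ∑' n : ℤ, cexp (2 * Real.pi * I * (c * (n : ℂ) ^ 2 / m)) *
        cexp (-Real.pi * w d * (n : ℂ) ^ 2) =
      ((I / (B * D d)) ^ (1 / 2 : ℂ) / ((D d)⁻¹) ^ (1 / 2 : ℂ)) * ((d : ℂ) ^ (1 / 2 : ℂ) *
      ∑' n : ℤ, cexp (-Real.pi * I * ((n : ℂ) ^ 2 * m / (2 * c))) *
        cexp (-Real.pi * d * (n : ℂ) ^ 2)) := by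
    filter_upwards [hpos] with d hd
    have hre : 0 < ((D d)⁻¹).re := by
      rw [inv_re, hDre]
      exact div_pos hd (normSq_pos.mpr (hD0 d))
    have key := Complex.tsum_exp_neg_mul_int_sq hre
    have e1 : ∑' n : ℤ, cexp (2 * Real.pi * I * (c * (n : ℂ) ^ 2 / m)) *
        cexp (-Real.pi * w d * (n : ℂ) ^ 2) =
        ∑' n : ℤ, cexp (-Real.pi * (D d)⁻¹ * (n : ℂ) ^ 2) := by
      refine tsum_congr fun n => ?_
      rw [← Complex.exp_add]
      congr 1
      simp only [w, hBe]
      field_simp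
      ring
    have e2 : ∑' n : ℤ, cexp (-Real.pi * I * ((n : ℂ) ^ 2 * m / (2 * c))) *
        cexp (-Real.pi * d * (n : ℂ) ^ 2) = ∑' n : ℤ, cexp (-Real.pi / (D d)⁻¹ * (n : ℂ) ^ 2) := by
      refine tsum_congr fun n => ?_
      rw [← Complex.exp_add]
      congr 1
      rw [div_inv_eq_mul]
      simp only [D, hBe]
      field_simp
      ring
    rw [e1, e2, key, hw,
      ofReal_mul_cpow_of_pos hd (div_ne_zero I_ne_zero (mul_ne_zero hBC (hD0 d)))]
    ring
  have hfac : Tendsto (fun d : ℝ => (I / (B * D d)) ^ (1 / 2 : ℂ) / ((D d)⁻¹) ^ (1 / 2 : ℂ))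
      (𝓝[>] 0) (𝓝 (cexp (Real.pi * I / 4) / Real.sqrt B)) := by
    have hval : I / (B * D 0) = ((B⁻¹ ^ 2 : ℝ) : ℂ) := by
      simp only [D]; push_cast; field_simp; ring
    have hval' : (D 0)⁻¹ = ((B⁻¹ : ℝ) : ℂ) * (-I) := by
      simp only [D]; push_cast; field_simp; ring_nf; simp
    have h0 : cexp (Real.pi * I / 4) / Real.sqrt B =
        (I / (B * D 0)) ^ (1 / 2 : ℂ) / ((D 0)⁻¹) ^ (1 / 2 : ℂ) := by
      have hI : -I ≠ 0 := neg_ne_zero.mpr I_ne_zero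
      rw [hval, hval', ofReal_cpow_half (by positivity), ofReal_mul_cpow_of_pos (by positivity) hI,
        ofReal_cpow_half (by positivity), Real.sqrt_sq (by positivity),
        cpow_def_of_ne_zero hI, log_neg_I]
      have e3 : cexp (-(Real.pi / 2) * I * (1 / 2)) = (cexp (Real.pi * I / 4))⁻¹ := by
        rw [← Complex.exp_neg]; congr 1; ring
      have hs : (Real.sqrt B : ℂ) ≠ 0 := by exact_mod_cast (Real.sqrt_pos.mpr hB0).ne'
      have hs2 : (Real.sqrt B : ℂ) ^ 2 = B := by exact_mod_cast Real.sq_sqrt hB0.le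
      rw [e3, Real.sqrt_inv]
      push_cast
      field_simp
      rw [← hs2]
    rw [h0]
    have hDc : Continuous D := by fun_prop
    refine tendsto_nhdsWithin_of_tendsto_nhds (ContinuousAt.tendsto ?_)
    have c1 : ContinuousAt (fun d => I / (B * D d)) 0 :=
      continuousAt_const.div (by fun_prop) (mul_ne_zero hBC (hD0 0))
    have c2 : ContinuousAt (fun d => (D d)⁻¹) 0 := hDc.continuousAt.inv₀ (hD0 0)
    refine (c1.cpow continuousAt_const ?_).div (c2.cpow continuousAt_const ?_) ?_
    · rw [hval]
      exact ofReal_mem_slitPlane.mpr (by positivity)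
    -- `(D 0)⁻¹ = -i / B` lies off the branch cut of the square root.
    · rw [hval']
      refine Or.inr ?_
      rw [im_ofReal_mul, neg_im, I_im]
      exact mul_ne_zero (by positivity) (by norm_num)
    · rw [cpow_ne_zero_iff]
      exact Or.inl (inv_ne_zero (hD0 0))
  have huniq := tendsto_nhds_unique (L1.congr' heq) (hfac.mul L2)
  have hs : (Real.sqrt B : ℂ) ≠ 0 := by exact_mod_cast (Real.sqrt_pos.mpr hB0).ne'
  have hs2 : (m : ℂ) = 2 * c * (Real.sqrt B : ℂ) ^ 2 := by
    rw [show (Real.sqrt B : ℂ) ^ 2 = B by exact_mod_cast Real.sq_sqrt hB0.le, hBe]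
    field_simp
  simp only [Int.cast_natCast] at huniq
  rw [div_eq_iff hmC] at huniq
  rw [huniq]
  push_cast
  generalize ∑ r ∈ Finset.range (2 * c), cexp (-Real.pi * I * ((r : ℂ) ^ 2 * m / (2 * c))) = S
  rw [hs2]
  field_simp

/-! ### Real primitive characters and the Chinese remainder theorem -/

section

namespace DirichletCharacter

theorem factorsThrough_iff_forall {n d : ℕ} [NeZero n] {χ : DirichletCharacter ℂ n} (hd : d ∣ n) :
    χ.FactorsThrough d ↔
      ∀ x : ZMod n, IsUnit x → ZMod.castHom hd (ZMod d) x = 1 → χ x = 1 := by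
  rw [factorsThrough_iff_ker_unitsMap hd]
  constructor
  · rintro h x ⟨u, rfl⟩ hx
    have hu : u ∈ (ZMod.unitsMap hd).ker := by
      rw [MonoidHom.mem_ker]
      ext
      simpa [ZMod.unitsMap_val] using hx
    have := h hu
    rw [MonoidHom.mem_ker] at this
    simpa using congrArg Units.val this
  · intro h u hu
    rw [MonoidHom.mem_ker] at hu ⊢
    ext
    have h2 := congrArg Units.val hu
    rw [ZMod.unitsMap_val] at h2
    simpa using h u u.isUnit (by simpa using h2)

theorem not_isPrimitive_of_forall {n d : ℕ} [NeZero n] {χ : DirichletCharacter ℂ n} (hd : d ∣ n)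
    (hdn : d < n) (h : ∀ x : ZMod n, IsUnit x → ZMod.castHom hd (ZMod d) x = 1 → χ x = 1) :
    ¬ χ.IsPrimitive := by
  intro hp
  have : χ.conductor ≤ d := Nat.sInf_le ((factorsThrough_iff_forall hd).mpr h)
  rw [(isPrimitive_def χ).mp hp] at this
  omega

/-- The component modulo `a` of a Dirichlet character modulo `a * b`, with `a` and `b` coprime: the
restriction of `χ` to the residues that are `1` modulo `b`. -/
noncomputable def crtLeft {a b : ℕ} (h : a.Coprime b) (χ : DirichletCharacter ℂ (a * b)) :
    DirichletCharacter ℂ a where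
  toFun x := χ ((ZMod.chineseRemainder h).symm (x, 1))
  map_one' := by
    rw [show ((1 : ZMod a), (1 : ZMod b)) = 1 from rfl, map_one, map_one]
  map_mul' x y := by
    rw [← map_mul, ← map_mul, Prod.mk_mul_mk, one_mul]
  map_nonunit' x hx := by
    refine χ.map_nonunit fun hu => hx ?_
    rw [MulEquiv.isUnit_map, Prod.isUnit_iff] at hu
    exact hu.1

/-- The component modulo `b` of a Dirichlet character modulo `a * b`, with `a` and `b` coprime: the
restriction of `χ` to the residues that are `1` modulo `a`. -/
noncomputable def crtRight {a b : ℕ} (h : a.Coprime b) (χ : DirichletCharacter ℂ (a * b)) :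
    DirichletCharacter ℂ b where
  toFun x := χ ((ZMod.chineseRemainder h).symm (1, x))
  map_one' := by
    rw [show ((1 : ZMod a), (1 : ZMod b)) = 1 from rfl, map_one, map_one]
  map_mul' x y := by
    rw [← map_mul, ← map_mul, Prod.mk_mul_mk, one_mul]
  map_nonunit' x hx := by
    refine χ.map_nonunit fun hu => hx ?_
    rw [MulEquiv.isUnit_map, Prod.isUnit_iff] at hu
    exact hu.2

section
variable {a b : ℕ} (h : a.Coprime b) (χ : DirichletCharacter ℂ (a * b))

theorem crtLeft_apply (x : ZMod a) :
    crtLeft h χ x = χ ((ZMod.chineseRemainder h).symm (x, 1)) := rfl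

theorem crtRight_apply (x : ZMod b) :
    crtRight h χ x = χ ((ZMod.chineseRemainder h).symm (1, x)) := rfl

theorem apply_chineseRemainder_symm (x : ZMod a) (y : ZMod b) :
    χ ((ZMod.chineseRemainder h).symm (x, y)) = crtLeft h χ x * crtRight h χ y := by
  rw [crtLeft_apply, crtRight_apply, ← map_mul, ← map_mul, Prod.mk_mul_mk, one_mul, mul_one]

theorem chineseRemainder_fst (x : ZMod (a * b)) :
    (ZMod.chineseRemainder h x).1 = ZMod.castHom (Dvd.intro b rfl) (ZMod a) x := by
  exact congrFun (congrArg DFunLike.coe (Subsingleton.elim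
    ((RingHom.fst _ _).comp (ZMod.chineseRemainder h : ZMod (a * b) →+* ZMod a × ZMod b))
    (ZMod.castHom (Dvd.intro b rfl) (ZMod a)))) x

theorem chineseRemainder_snd (x : ZMod (a * b)) :
    (ZMod.chineseRemainder h x).2 = ZMod.castHom (Dvd.intro_left a rfl) (ZMod b) x := by
  exact congrFun (congrArg DFunLike.coe (Subsingleton.elim
    ((RingHom.snd _ _).comp (ZMod.chineseRemainder h : ZMod (a * b) →+* ZMod a × ZMod b))
    (ZMod.castHom (Dvd.intro_left a rfl) (ZMod b)))) x

variable {χ}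

/-- If the component modulo `a` had a conductor `d < a`, then `χ` would factor through `d * b`. -/
theorem IsPrimitive.crtLeft [NeZero a] [NeZero b] (hχ : χ.IsPrimitive) :
    (crtLeft h χ).IsPrimitive := by
  by_contra hp
  have hdvd := (DirichletCharacter.crtLeft h χ).conductor_dvd_level
  have hlt : (DirichletCharacter.crtLeft h χ).conductor < a :=
    lt_of_le_of_ne (Nat.le_of_dvd (NeZero.pos a) hdvd) hp
  have hf := (factorsThrough_iff_forall hdvd).mp
    (DirichletCharacter.crtLeft h χ).factorsThrough_conductor
  refine not_isPrimitive_of_forall (mul_dvd_mul_right hdvd b)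
    (Nat.mul_lt_mul_of_pos_right hlt (NeZero.pos b)) (fun x hx hx1 => ?_) hχ
  obtain ⟨⟨u, v⟩, rfl⟩ := (ZMod.chineseRemainder h).symm.surjective x
  rw [MulEquiv.isUnit_map, Prod.isUnit_iff] at hx
  have hu := chineseRemainder_fst h ((ZMod.chineseRemainder h).symm (u, v))
  have hv := chineseRemainder_snd h ((ZMod.chineseRemainder h).symm (u, v))
  rw [RingEquiv.apply_symm_apply] at hu hv
  have hv1 : v = 1 := by
    have := congrArg (ZMod.castHom (Dvd.intro_left _ rfl) (ZMod b)) hx1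
    rw [← RingHom.comp_apply, ZMod.castHom_comp, map_one] at this
    rw [← this]; exact hv
  have hu1 : ZMod.castHom hdvd (ZMod (DirichletCharacter.crtLeft h χ).conductor) u = 1 := by
    have := congrArg (ZMod.castHom (Dvd.intro b rfl)
      (ZMod (DirichletCharacter.crtLeft h χ).conductor)) hx1
    rw [← RingHom.comp_apply, ZMod.castHom_comp, map_one] at this
    rw [← this]
    simp only at hu
    conv_lhs => rw [hu]
    rw [← RingHom.comp_apply, ZMod.castHom_comp]
  rw [apply_chineseRemainder_symm, hv1, map_one, mul_one]
  exact hf u hx.1 hu1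

theorem IsPrimitive.crtRight [NeZero a] [NeZero b] (hχ : χ.IsPrimitive) :
    (crtRight h χ).IsPrimitive := by
  by_contra hp
  have hdvd := (DirichletCharacter.crtRight h χ).conductor_dvd_level
  have hlt : (DirichletCharacter.crtRight h χ).conductor < b :=
    lt_of_le_of_ne (Nat.le_of_dvd (NeZero.pos b) hdvd) hp
  have hf := (factorsThrough_iff_forall hdvd).mp
    (DirichletCharacter.crtRight h χ).factorsThrough_conductor
  refine not_isPrimitive_of_forall (mul_dvd_mul_left a hdvd)
    (Nat.mul_lt_mul_of_pos_left hlt (NeZero.pos a)) (fun x hx hx1 => ?_) hχ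
  obtain ⟨⟨u, v⟩, rfl⟩ := (ZMod.chineseRemainder h).symm.surjective x
  rw [MulEquiv.isUnit_map, Prod.isUnit_iff] at hx
  have hu := chineseRemainder_fst h ((ZMod.chineseRemainder h).symm (u, v))
  have hv := chineseRemainder_snd h ((ZMod.chineseRemainder h).symm (u, v))
  rw [RingEquiv.apply_symm_apply] at hu hv
  have hu1 : u = 1 := by
    have := congrArg (ZMod.castHom (Dvd.intro _ rfl) (ZMod a)) hx1
    rw [← RingHom.comp_apply, ZMod.castHom_comp, map_one] at this
    rw [← this]; exact hu
  have hv1 : ZMod.castHom hdvd (ZMod (DirichletCharacter.crtRight h χ).conductor) v = 1 := by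
    have := congrArg (ZMod.castHom (Dvd.intro_left a rfl)
      (ZMod (DirichletCharacter.crtRight h χ).conductor)) hx1
    rw [← RingHom.comp_apply, ZMod.castHom_comp, map_one] at this
    rw [← this]
    simp only at hv
    conv_lhs => rw [hv]
    rw [← RingHom.comp_apply, ZMod.castHom_comp]
  rw [apply_chineseRemainder_symm, hu1, map_one, one_mul]
  exact hf v hx.2 hv1

end

end DirichletCharacter

namespace AddChar

section
variable {a b : ℕ} (h : a.Coprime b) (ψ : AddChar (ZMod (a * b)) ℂ)

/-- The component modulo `a` of an additive character of `ZMod (a * b)`: its restriction to the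
residues that are `0` modulo `b`. -/
noncomputable def crtLeft : AddChar (ZMod a) ℂ where
  toFun x := ψ ((ZMod.chineseRemainder h).symm (x, 0))
  map_zero_eq_one' := by
    rw [show ((0 : ZMod a), (0 : ZMod b)) = 0 from rfl, map_zero, map_zero_eq_one]
  map_add_eq_mul' x y := by
    rw [← map_add_eq_mul, ← map_add, Prod.mk_add_mk, add_zero]

/-- The component modulo `b` of an additive character of `ZMod (a * b)`: its restriction to the
residues that are `0` modulo `a`. -/
noncomputable def crtRight : AddChar (ZMod b) ℂ where
  toFun x := ψ ((ZMod.chineseRemainder h).symm (0, x))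
  map_zero_eq_one' := by
    rw [show ((0 : ZMod a), (0 : ZMod b)) = 0 from rfl, map_zero, map_zero_eq_one]
  map_add_eq_mul' x y := by
    rw [← map_add_eq_mul, ← map_add, Prod.mk_add_mk, add_zero]

theorem crtLeft_apply (x : ZMod a) :
    crtLeft h ψ x = ψ ((ZMod.chineseRemainder h).symm (x, 0)) := rfl

theorem crtRight_apply (x : ZMod b) :
    crtRight h ψ x = ψ ((ZMod.chineseRemainder h).symm (0, x)) := rfl

theorem apply_chineseRemainder_symm (x : ZMod a) (y : ZMod b) :
    ψ ((ZMod.chineseRemainder h).symm (x, y)) = crtLeft h ψ x * crtRight h ψ y := by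
  rw [crtLeft_apply, crtRight_apply, ← map_add_eq_mul, ← map_add, Prod.mk_add_mk, zero_add,
    add_zero]

variable {ψ}

theorem IsPrimitive.crtLeft (hψ : ψ.IsPrimitive) : (crtLeft h ψ).IsPrimitive := by
  intro x hx h1
  refine hψ (a := (ZMod.chineseRemainder h).symm (x, 0)) ?_ ?_
  · rw [Ne, EmbeddingLike.map_eq_zero_iff, Prod.mk_eq_zero]
    exact fun h => hx h.1
  · ext y
    obtain ⟨⟨u, v⟩, rfl⟩ := (ZMod.chineseRemainder h).symm.surjective y
    have := DFunLike.congr_fun h1 u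
    rw [mulShift_apply, crtLeft_apply] at this
    rw [mulShift_apply, ← map_mul, Prod.mk_mul_mk, zero_mul, this, one_apply, one_apply]

theorem IsPrimitive.crtRight (hψ : ψ.IsPrimitive) : (crtRight h ψ).IsPrimitive := by
  intro x hx h1
  refine hψ (a := (ZMod.chineseRemainder h).symm (0, x)) ?_ ?_
  · rw [Ne, EmbeddingLike.map_eq_zero_iff, Prod.mk_eq_zero]
    exact fun h => hx h.2
  · ext y
    obtain ⟨⟨u, v⟩, rfl⟩ := (ZMod.chineseRemainder h).symm.surjective y
    have := DFunLike.congr_fun h1 v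
    rw [mulShift_apply, crtRight_apply] at this
    rw [mulShift_apply, ← map_mul, Prod.mk_mul_mk, zero_mul, this, one_apply, one_apply]

end

end AddChar

open DirichletCharacter in
theorem gaussSum_eq_crt {a b : ℕ} [NeZero a] [NeZero b] (h : a.Coprime b)
    (χ : DirichletCharacter ℂ (a * b)) (ψ : AddChar (ZMod (a * b)) ℂ) :
    gaussSum χ ψ =
      gaussSum (crtLeft h χ) (ψ.crtLeft h) * gaussSum (crtRight h χ) (ψ.crtRight h) := by
  simp only [gaussSum]
  rw [← (ZMod.chineseRemainder h).symm.toEquiv.sum_comp, Fintype.sum_prod_type, Finset.sum_mul_sum]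
  refine Finset.sum_congr rfl fun x _ => Finset.sum_congr rfl fun y _ => ?_
  change χ ((ZMod.chineseRemainder h).symm (x, y)) * ψ ((ZMod.chineseRemainder h).symm (x, y)) = _
  rw [DirichletCharacter.apply_chineseRemainder_symm, AddChar.apply_chineseRemainder_symm]
  ring

theorem sum_addChar_sq_eq_crt {a b : ℕ} [NeZero a] [NeZero b] (h : a.Coprime b)
    (ψ : AddChar (ZMod (a * b)) ℂ) :
    ∑ x, ψ (x ^ 2) = (∑ x, ψ.crtLeft h (x ^ 2)) * ∑ x, ψ.crtRight h (x ^ 2) := by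
  rw [← (ZMod.chineseRemainder h).symm.toEquiv.sum_comp, Fintype.sum_prod_type, Finset.sum_mul_sum]
  refine Finset.sum_congr rfl fun x _ => Finset.sum_congr rfl fun y _ => ?_
  change ψ ((ZMod.chineseRemainder h).symm (x, y) ^ 2) = _
  rw [← map_pow, Prod.pow_mk, AddChar.apply_chineseRemainder_symm]

open DirichletCharacter

theorem MulChar.IsQuadratic.crtLeft {a b : ℕ} (h : a.Coprime b) {χ : DirichletCharacter ℂ (a * b)}
    (hχ : χ.IsQuadratic) : (crtLeft h χ).IsQuadratic := fun _ => hχ _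

theorem MulChar.IsQuadratic.crtRight {a b : ℕ} (h : a.Coprime b) {χ : DirichletCharacter ℂ (a * b)}
    (hχ : χ.IsQuadratic) : (crtRight h χ).IsQuadratic := fun _ => hχ _

theorem ZMod.exists_eq_one_add_mul {n d : ℕ} [NeZero n] (hd : d ∣ n) {x : ZMod n}
    (hx : ZMod.castHom hd (ZMod d) x = 1) : ∃ t : ZMod n, x = 1 + d * t := by
  obtain ⟨j, rfl⟩ := ZMod.intCast_surjective x
  rw [map_intCast, ← Int.cast_one, ZMod.intCast_eq_intCast_iff_dvd_sub] at hx
  obtain ⟨t, ht⟩ := hx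
  refine ⟨-t, ?_⟩
  rw [show j = 1 + d * (-t) by linarith]
  push_cast
  ring

/-- A real character modulo `p ^ k`, with `p` odd and `2 ≤ k`, factors through `p ^ (k - 1)`: the
kernel of reduction has odd exponent `p`, so a character with values `±1` is trivial on it. -/
theorem DirichletCharacter.not_isPrimitive_of_odd_prime_pow {p k : ℕ} (hp : p.Prime) (hp2 : p ≠ 2)
    (hk : 2 ≤ k) {χ : DirichletCharacter ℂ (p ^ k)} (hχ : χ.IsQuadratic) : ¬ χ.IsPrimitive := by
  have : NeZero (p ^ k) := ⟨pow_ne_zero _ hp.ne_zero⟩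
  refine not_isPrimitive_of_forall (d := p ^ (k - 1)) (pow_dvd_pow p (Nat.sub_le k 1))
    (Nat.pow_lt_pow_right hp.one_lt (by omega)) fun x hx h1 => ?_
  have hxp : x ^ p = 1 := by
    obtain ⟨t, rfl⟩ := ZMod.exists_eq_one_add_mul _ h1
    set y : ZMod (p ^ k) := ((p ^ (k - 1) : ℕ) : ZMod (p ^ k)) * t with hy
    have h0 : ((p ^ k : ℕ) : ZMod (p ^ k)) = 0 := ZMod.natCast_self _
    have hyy : y * y = 0 := by
      obtain ⟨j, hj⟩ := pow_dvd_pow p (show k ≤ (k - 1) + (k - 1) by omega)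
      have : y * y = ((p ^ k * j : ℕ) : ZMod (p ^ k)) * (t * t) := by
        rw [← hj, pow_add]; push_cast; rw [hy]; push_cast; ring
      rw [this, Nat.cast_mul, h0]; ring
    have hpy : p * y = 0 := by
      have : p * y = ((p ^ k : ℕ) : ZMod (p ^ k)) * t := by
        rw [hy, ← mul_assoc, ← Nat.cast_mul, ← pow_succ', Nat.sub_add_cancel (by omega)]
      rw [this, h0, zero_mul]
    have hpow (i : ℕ) : (1 + y) ^ i = 1 + i * y := by
      induction i with
      | zero => simp
      | succ i ih => rw [pow_succ, ih]; push_cast; linear_combination i * hyy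
    rw [hpow, hpy, add_zero]
  have h2 : χ x ^ p = 1 := by rw [← map_pow, hxp, map_one]
  rcases hχ x with h | h | h
  · rw [h, zero_pow hp.ne_zero] at h2; exact absurd h2 zero_ne_one
  · exact h
  · rw [h, (hp.odd_of_ne_two hp2).neg_one_pow] at h2
    norm_num at h2

/-- A real character modulo `2 ^ k`, with `4 ≤ k`, factors through `2 ^ (k - 1)`: the kernel of
reduction consists of squares. -/
theorem DirichletCharacter.not_isPrimitive_two_pow {k : ℕ}
    (hk : 4 ≤ k) {χ : DirichletCharacter ℂ (2 ^ k)} (hχ : χ.IsQuadratic) : ¬ χ.IsPrimitive := by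
  have : NeZero (2 ^ k) := ⟨pow_ne_zero _ two_ne_zero⟩
  refine not_isPrimitive_of_forall (d := 2 ^ (k - 1)) (pow_dvd_pow 2 (Nat.sub_le k 1))
    (Nat.pow_lt_pow_right one_lt_two (by omega)) fun x hx h1 => ?_
  obtain ⟨y, rfl⟩ : ∃ y, x = y ^ 2 := by
    obtain ⟨t, rfl⟩ := ZMod.exists_eq_one_add_mul _ h1
    have h0 : ((2 ^ k : ℕ) : ZMod (2 ^ k)) = 0 := ZMod.natCast_self _
    obtain ⟨j, rfl⟩ := Nat.exists_eq_add_of_le hk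
    refine ⟨1 + 2 ^ (2 + j) * t, ?_⟩
    rw [show 4 + j - 1 = 3 + j by omega]
    have h1 : (2 ^ (4 + j) : ZMod (2 ^ (4 + j))) = 0 := by exact_mod_cast h0
    push_cast
    linear_combination - 2 ^ j * t ^ 2 * h1
  rcases hχ y with h | h | h
  · exfalso
    have := (MulChar.apply_ne_zero_iff (χ := χ)).mpr hx
    simp [h] at this
  all_goals simp [h]

/-- A finite field has only one nontrivial real character. -/
theorem MulChar.IsQuadratic.eq_quadraticChar {F : Type*} [Field F] [Fintype F] [DecidableEq F]
    {χ : MulChar F ℂ} (hχ : χ.IsQuadratic) (h1 : χ ≠ 1) (x : F) :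
    χ x = (quadraticChar F x : ℂ) := by
  have hsq : ∀ y : F, y ≠ 0 → IsSquare y → χ y = 1 := by
    rintro _ hy ⟨z, rfl⟩
    have hz : z ≠ 0 := fun h => hy (by simp [h])
    have := (MulChar.apply_ne_zero_iff (χ := χ)).mpr hz.isUnit
    rw [map_mul]
    rcases hχ z with h | h | h
    · exact absurd h this
    all_goals simp [h]
  by_cases hx : x = 0
  · simp [hx]
  by_cases hs : IsSquare x
  · rw [hsq x hx hs, (quadraticChar_one_iff_isSquare hx).mpr hs, Int.cast_one]
  · obtain ⟨a, ha⟩ := MulChar.ne_one_iff.mp h1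
    have ha0 : (a : F) ≠ 0 := a.ne_zero
    have has : ¬ IsSquare (a : F) := fun h => ha (hsq _ ha0 h)
    have hax : IsSquare ((a : F) * x) := by
      rw [← quadraticChar_one_iff_isSquare (mul_ne_zero ha0 hx), map_mul,
        quadraticChar_neg_one_iff_not_isSquare.mpr hs,
        quadraticChar_neg_one_iff_not_isSquare.mpr has]
      norm_num
    have h2 := hsq _ (mul_ne_zero ha0 hx) hax
    have ha1 : χ a = -1 := by
      rcases hχ a with h | h | h
      · exact absurd h ((MulChar.apply_ne_zero_iff (χ := χ)).mpr a.isUnit)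
      · exact absurd h ha
      · exact h
    rw [map_mul, ha1] at h2
    rw [quadraticChar_neg_one_iff_not_isSquare.mpr hs]
    push_cast
    linear_combination -h2

/-- In a finite field of odd characteristic `x ^ 2 = a` has `1 + χ a` solutions, and the constant
`1` contributes nothing to `∑ ψ (x ^ 2)`. -/
theorem gaussSum_eq_sum_sq {F : Type*} [Field F] [Fintype F] (hF : ringChar F ≠ 2)
    {χ : MulChar F ℂ} (hχ : χ.IsQuadratic) (h1 : χ ≠ 1) {ψ : AddChar F ℂ} (hψ : ψ ≠ 1) :
    gaussSum χ ψ = ∑ x, ψ (x ^ 2) := by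
  classical
  have hfib : ∑ x, ψ (x ^ 2) = ∑ a, ((quadraticChar F a + 1 : ℤ) : ℂ) * ψ a := by
    rw [← Finset.sum_fiberwise (s := Finset.univ) (g := fun x : F => x ^ 2)]
    refine Finset.sum_congr rfl fun a _ => ?_
    rw [← quadraticChar_card_sqrts hF a, Finset.sum_congr rfl (g := fun _ => ψ a)
      (fun x hx => by rw [(Finset.mem_filter.mp hx).2]), Finset.sum_const, nsmul_eq_mul]
    congr 2
    congr 2
    ext x
    simp
  rw [hfib, gaussSum]
  push_cast
  simp_rw [add_mul, one_mul, Finset.sum_add_distrib, AddChar.sum_eq_zero_of_ne_one hψ, add_zero,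
    hχ.eq_quadraticChar h1]

theorem DirichletCharacter.IsPrimitive.ne_one {n : ℕ} [NeZero n] {χ : DirichletCharacter ℂ n}
    (hχ : χ.IsPrimitive) (hn : n ≠ 1) : χ ≠ 1 := by
  rintro rfl
  rw [isPrimitive_def, conductor_one] at hχ
  exact hn hχ.symm

/-- The statement covers all primitive `ψ`, not only the standard character, because the Chinese
remainder theorem does not send standard additive characters to standard ones. -/
theorem gaussSum_eq_sum_sq_of_odd {m : ℕ} [NeZero m] (hm : _root_.Odd m)
    {χ : DirichletCharacter ℂ m}
    (hχ : χ.IsQuadratic) (hχp : χ.IsPrimitive) {ψ : AddChar (ZMod m) ℂ} (hψ : ψ.IsPrimitive) :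
    gaussSum χ ψ = ∑ x, ψ (x ^ 2) := by
  suffices H : ∀ m : ℕ, ∀ [NeZero m], _root_.Odd m → ∀ {χ : DirichletCharacter ℂ m},
      χ.IsQuadratic → χ.IsPrimitive → ∀ {ψ : AddChar (ZMod m) ℂ}, ψ.IsPrimitive →
      gaussSum χ ψ = ∑ x, ψ (x ^ 2) from H m hm hχ hχp hψ
  clear! m
  intro m
  induction m using Nat.recOnPosPrimePosCoprime with
  | zero => intro _ hm; simp at hm
  | one =>
    intro _ hm χ hχ hχp ψ hψ
    simp only [gaussSum]
    rw [Fintype.sum_subsingleton _ 1, Fintype.sum_subsingleton _ 1]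
    simp
  | prime_pow p n hp hn =>
    intro _ hm χ hχ hχp ψ hψ
    have hp2 : p ≠ 2 := by
      rintro rfl
      exact (Nat.not_odd_iff_even.mpr ((even_two).pow_of_ne_zero hn.ne')) hm
    rcases Nat.lt_or_ge n 2 with h | h
    · obtain rfl : n = 1 := by omega
      -- Replace the modulus `p ^ 1` by `p`, whose residue ring is a field.
      clear hm
      revert χ ψ
      generalize hq : p ^ 1 = q at *
      intro χ hχ hχp ψ hψ
      rw [pow_one] at hq
      subst hq
      have : Fact p.Prime := ⟨hp⟩
      have := gaussSum_eq_sum_sq (F := ZMod p) (by rwa [ZMod.ringChar_zmod_n]) hχ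
        (hχp.ne_one hp.ne_one) (ψ := ψ) (by simpa using hψ (one_ne_zero))
      convert this
    · exact absurd hχp (not_isPrimitive_of_odd_prime_pow hp hp2 h hχ)
  | coprime a b ha hb hab iha ihb =>
    intro _ hm χ hχ hχp ψ hψ
    have : NeZero a := ⟨by omega⟩
    have : NeZero b := ⟨by omega⟩
    rw [Nat.odd_mul] at hm
    have h1 := gaussSum_eq_crt hab χ ψ
    rw [iha hm.1 (hχ.crtLeft hab) (hχp.crtLeft hab) (hψ.crtLeft hab),
      ihb hm.2 (hχ.crtRight hab) (hχp.crtRight hab) (hψ.crtRight hab),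
      ← sum_addChar_sq_eq_crt hab] at h1
    convert h1

end

/-! ### The sign of the quadratic Gauss sum -/

section

open Complex ZMod

theorem ZMod.sum_eq_sum_range {n : ℕ} [NeZero n] {M : Type*} [AddCommMonoid M] (f : ZMod n → M) :
    ∑ x, f x = ∑ r ∈ Finset.range n, f r := by
  refine Finset.sum_nbij' (fun x => x.val) (fun r => (r : ZMod n)) ?_ ?_ ?_ ?_ ?_
  · intro x _; exact Finset.mem_range.mpr x.val_lt
  · intro r _; exact Finset.mem_univ _
  · intro x _; exact ZMod.natCast_zmod_val x
  · intro r hr; exact ZMod.val_cast_of_lt (Finset.mem_range.mp hr)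
  · intro x _; rw [ZMod.natCast_zmod_val]


theorem sum_stdAddChar_mul_sq {m c : ℕ} [NeZero m] :
    ∑ x : ZMod m, stdAddChar ((c : ZMod m) * x ^ 2) =
      ∑ r ∈ Finset.range m, cexp (2 * Real.pi * I * (c * (r : ℂ) ^ 2 / m)) := by
  rw [ZMod.sum_eq_sum_range]
  refine Finset.sum_congr rfl fun r _ => ?_
  have := stdAddChar_coe (N := m) (c * r ^ 2 : ℤ)
  push_cast at this
  rw [this]
  congr 1
  ring

theorem stdAddChar_natCast {n : ℕ} [NeZero n] (j : ℕ) :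
    stdAddChar (j : ZMod n) = cexp (2 * Real.pi * I / n) ^ j := by
  rw [← Complex.exp_nat_mul, ← Int.cast_natCast, stdAddChar_coe]
  congr 1
  push_cast
  ring

theorem exp_neg_pi_mul_I_div_two_pow (n : ℕ) : cexp (-Real.pi * I / 2 * n) = (-I) ^ n := by
  rw [mul_comm, Complex.exp_nat_mul]
  congr 1
  rw [show -(Real.pi : ℂ) * I / 2 = -(Real.pi / 2 * I) by ring, Complex.exp_neg,
    exp_pi_div_two_mul_I, inv_I]

theorem exp_pi_mul_I_div_four_mul_sqrt_two :
    cexp (Real.pi * I / 4) * Real.sqrt 2 = 1 + I := by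
  have h : (Real.sqrt 2 : ℂ) ^ 2 = 2 := by exact_mod_cast Real.sq_sqrt (zero_le_two)
  rw [show (Real.pi : ℂ) * I / 4 = ((Real.pi / 4 : ℝ) : ℂ) * I by push_cast; ring, exp_mul_I,
    ← ofReal_cos, ← ofReal_sin, Real.cos_pi_div_four, Real.sin_pi_div_four]
  push_cast
  linear_combination (1 + I) / 2 * h

theorem exp_pi_mul_I_div_four_sq : cexp (Real.pi * I / 4) ^ 2 = I := by
  rw [← Complex.exp_nat_mul, show ((2 : ℕ) : ℂ) * (Real.pi * I / 4) = Real.pi / 2 * I by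
    push_cast; ring, exp_pi_div_two_mul_I]

theorem sum_stdAddChar_sq {m : ℕ} [NeZero m] :
    ∑ x : ZMod m, stdAddChar (x ^ 2) = (Real.sqrt m : ℂ) * ((1 + I) / 2) * (1 + (-I) ^ m) := by
  have h1 := sum_stdAddChar_mul_sq (m := m) (c := 1)
  rw [sum_exp_sq_eq (NeZero.pos m) one_pos] at h1
  simp only [Nat.cast_one, one_mul, mul_one, Finset.sum_range_succ, Finset.sum_range_zero] at h1
  rw [h1, Real.sqrt_div (by positivity), ← exp_neg_pi_mul_I_div_two_pow,
    ← exp_pi_mul_I_div_four_mul_sqrt_two]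
  have h : (Real.sqrt 2 : ℂ) ^ 2 = 2 := by exact_mod_cast Real.sq_sqrt (zero_le_two)
  have h0 : (Real.sqrt 2 : ℂ) ≠ 0 := by exact_mod_cast (Real.sqrt_pos.mpr two_pos).ne'
  have e1 : -(Real.pi : ℂ) * I * ((1 : ℂ) ^ 2 * m / 2) = -Real.pi * I / 2 * m := by ring
  rw [e1]
  push_cast
  simp only [zero_add, ne_eq, OfNat.ofNat_ne_zero, not_false_eq_true, zero_pow, zero_mul, zero_div,
    mul_zero, Complex.exp_zero]
  field_simp
  rw [h]

theorem sum_stdAddChar_sq_of_mod_four_eq_one {m : ℕ} [NeZero m] (hm : m % 4 = 1) :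
    ∑ x : ZMod m, stdAddChar (x ^ 2) = (Real.sqrt m : ℂ) := by
  have h : (-I) ^ m = -I := by
    rw [← Nat.div_add_mod m 4, hm, pow_add, pow_mul]
    have : (-I) ^ 4 = 1 := by rw [(by decide : Even 4).neg_pow, I_pow_four]
    rw [this, one_pow, one_mul, pow_one]
  rw [sum_stdAddChar_sq, h]
  linear_combination (-(Real.sqrt m : ℂ) / 2) * I_sq

theorem sum_stdAddChar_sq_of_mod_four_eq_three {m : ℕ} [NeZero m] (hm : m % 4 = 3) :
    ∑ x : ZMod m, stdAddChar (x ^ 2) = I * (Real.sqrt m : ℂ) := by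
  have h : (-I) ^ m = I := by
    rw [← Nat.div_add_mod m 4, hm, pow_add, pow_mul]
    have : (-I) ^ 4 = 1 := by rw [(by decide : Even 4).neg_pow, I_pow_four]
    rw [this, one_pow, one_mul, (by decide : Odd 3).neg_pow, I_pow_three, neg_neg]
  rw [sum_stdAddChar_sq, h]
  linear_combination ((Real.sqrt m : ℂ) / 2) * I_sq

theorem sum_stdAddChar_two_mul_sq {m : ℕ} [NeZero m] (hm : Odd m) :
    ∑ x : ZMod m, stdAddChar (2 * x ^ 2) =
      (Real.sqrt m : ℂ) * cexp (Real.pi * I / 4) * cexp (-Real.pi * I / 4) ^ m := by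
  have h1 := sum_stdAddChar_mul_sq (m := m) (c := 2)
  rw [sum_exp_sq_eq (NeZero.pos m) two_pos] at h1
  push_cast at h1
  rw [h1, show (m : ℝ) / (2 * 2) = m / 2 ^ 2 by norm_num, Real.sqrt_div (by positivity),
    Real.sqrt_sq zero_le_two]
  simp only [Finset.sum_range_succ, Finset.sum_range_zero]
  have e0 : cexp (-Real.pi * I * (((0 : ℕ) : ℂ) ^ 2 * m / (2 * 2))) = 1 := by simp
  have e1 : cexp (-Real.pi * I * (((1 : ℕ) : ℂ) ^ 2 * m / (2 * 2))) =
      cexp (-Real.pi * I / 4) ^ m := by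
    rw [← Complex.exp_nat_mul]; congr 1; push_cast; ring
  have e2 : cexp (-Real.pi * I * (((2 : ℕ) : ℂ) ^ 2 * m / (2 * 2))) = -1 := by
    rw [← hm.neg_one_pow, ← exp_neg_pi_mul_I, ← Complex.exp_nat_mul]; congr 1; push_cast; ring
  have e3 : cexp (-Real.pi * I * (((3 : ℕ) : ℂ) ^ 2 * m / (2 * 2))) =
      cexp (-Real.pi * I / 4) ^ m := by
    rw [← Complex.exp_nat_mul, Complex.exp_eq_exp_iff_exists_int]
    exact ⟨-m, by push_cast; ring⟩
  rw [e0, e1, e2, e3]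
  push_cast
  ring

theorem MulChar.IsQuadratic.apply_neg_one_mul_conj_gaussSum {R : Type*} [CommRing R] [Fintype R]
    {χ : MulChar R ℂ} (hχ : χ.IsQuadratic) (ψ : AddChar R ℂ) :
    χ (-1) * starRingEnd ℂ (gaussSum χ ψ) = gaussSum χ ψ := by
  rw [starRingEnd_apply, star_gaussSum_eq, hχ.inv, AddChar.inv_mulShift]
  simpa using gaussSum_mulShift χ ψ (-1)

namespace DirichletCharacter

section
variable {m : ℕ} [NeZero m] {χ : DirichletCharacter ℂ m}

/-- The parity of a real primitive character is read off from the relation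
`χ(-1) * conj τ = τ`, since `τ = √m` is real. -/
theorem apply_neg_one_of_mod_four_eq_one (hχ : χ.IsQuadratic) (hχp : χ.IsPrimitive)
    (hm : m % 4 = 1) : χ (-1) = 1 := by
  have h := hχ.apply_neg_one_mul_conj_gaussSum stdAddChar
  rw [gaussSum_eq_sum_sq_of_odd (Nat.odd_iff.mpr (by omega)) hχ hχp (isPrimitive_stdAddChar m),
    sum_stdAddChar_sq_of_mod_four_eq_one hm, conj_ofReal] at h
  have h0 : (Real.sqrt m : ℂ) ≠ 0 := by
    exact_mod_cast (Real.sqrt_pos.mpr (by exact_mod_cast NeZero.pos m)).ne'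
  exact mul_right_cancel₀ h0 (h.trans (one_mul _).symm)

theorem apply_neg_one_of_mod_four_eq_three (hχ : χ.IsQuadratic) (hχp : χ.IsPrimitive)
    (hm : m % 4 = 3) : χ (-1) = -1 := by
  have h := hχ.apply_neg_one_mul_conj_gaussSum stdAddChar
  rw [gaussSum_eq_sum_sq_of_odd (Nat.odd_iff.mpr (by omega)) hχ hχp (isPrimitive_stdAddChar m),
    sum_stdAddChar_sq_of_mod_four_eq_three hm, map_mul, conj_I, conj_ofReal] at h
  have h0 : (I * (Real.sqrt m : ℂ)) ≠ 0 := mul_ne_zero I_ne_zero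
    (by exact_mod_cast (Real.sqrt_pos.mpr (by exact_mod_cast NeZero.pos m)).ne')
  refine mul_right_cancel₀ h0 ?_
  linear_combination -h

theorem gaussSum_of_odd_level (hχ : χ.IsQuadratic) (hχp : χ.IsPrimitive)
    (hm : _root_.Odd m) (hodd : χ (-1) = -1) :
    gaussSum χ stdAddChar = I * Real.sqrt m := by
  rw [gaussSum_eq_sum_sq_of_odd hm hχ hχp (isPrimitive_stdAddChar m)]
  refine sum_stdAddChar_sq_of_mod_four_eq_three ?_
  by_contra h
  have h1 := apply_neg_one_of_mod_four_eq_one hχ hχp (by rw [Nat.odd_iff] at hm; omega)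
  rw [hodd] at h1
  norm_num at h1

end

section
variable {a b : ℕ} [NeZero a] [NeZero b] (h : a.Coprime b)

theorem stdAddChar_crtLeft (x : ZMod a) :
    (stdAddChar (N := a * b)).crtLeft h (b * x) = stdAddChar x := by
  obtain ⟨j, rfl⟩ := ZMod.intCast_surjective x
  have h1 : ZMod.chineseRemainder h ((b * j : ℤ) : ZMod (a * b)) = ((b * j : ZMod a), 0) := by
    rw [map_intCast]; ext <;> simp
  have ha : (a : ℂ) ≠ 0 := NeZero.ne _
  have hb : (b : ℂ) ≠ 0 := NeZero.ne _
  rw [AddChar.crtLeft_apply, ← h1, RingEquiv.symm_apply_apply, stdAddChar_coe, stdAddChar_coe]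
  congr 1
  push_cast
  field_simp

theorem stdAddChar_crtRight (x : ZMod b) :
    (stdAddChar (N := a * b)).crtRight h (a * x) = stdAddChar x := by
  obtain ⟨j, rfl⟩ := ZMod.intCast_surjective x
  have h1 : ZMod.chineseRemainder h ((a * j : ℤ) : ZMod (a * b)) = (0, (a * j : ZMod b)) := by
    rw [map_intCast]; ext <;> simp
  have ha : (a : ℂ) ≠ 0 := NeZero.ne _
  have hb : (b : ℂ) ≠ 0 := NeZero.ne _
  rw [AddChar.crtRight_apply, ← h1, RingEquiv.symm_apply_apply, stdAddChar_coe, stdAddChar_coe]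
  congr 1
  push_cast
  field_simp

theorem crtLeft_neg_one_mul_crtRight_neg_one {a b : ℕ} (h : a.Coprime b)
    (χ : DirichletCharacter ℂ (a * b)) :
    crtLeft h χ (-1) * crtRight h χ (-1) = χ (-1) := by
  rw [← apply_chineseRemainder_symm, show ((-1 : ZMod a), (-1 : ZMod b)) = -1 from rfl, map_neg,
    map_one]

/-- The Gauss sum of a real primitive character modulo `a * b` with `b` odd. Multiplying the
variable modulo `b` by `c`, where `c ^ 2 = a * d`, and using `b ^ 2 = 1` modulo `a` makes both
additive characters standard; this applies to `a = 4, c = 2, d = 1` and to `a = 8, c = 4, d = 2`. -/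
theorem gaussSum_eq_sum_crtLeft_mul_sum_sq (hb : _root_.Odd b)
    {χ : DirichletCharacter ℂ (a * b)} (hχ : χ.IsQuadratic) (hχp : χ.IsPrimitive)
    {c : ℕ} (hc : c.Coprime b) (d : ℕ) (hcd : c ^ 2 = a * d) (hb2 : (b : ZMod a) ^ 2 = 1) :
    gaussSum χ stdAddChar = (∑ u : ZMod a, crtLeft h χ u * stdAddChar (b * u : ZMod a)) *
      ∑ v : ZMod b, stdAddChar (d * v ^ 2 : ZMod b) := by
  rw [gaussSum_eq_crt h, gaussSum_eq_sum_sq_of_odd hb (hχ.crtRight h) (hχp.crtRight h)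
    ((isPrimitive_stdAddChar _).crtRight h)]
  congr 1
  · refine Finset.sum_congr rfl fun u _ => ?_
    rw [← stdAddChar_crtLeft h, ← mul_assoc, ← sq, hb2, one_mul]
  · let e : ZMod b ≃ ZMod b := (ZMod.unitOfCoprime c hc).mulLeft
    rw [← e.sum_comp]
    refine Finset.sum_congr rfl fun v _ => ?_
    have he : e v = c * v := by simp [e]
    have hcd' : (c : ZMod b) ^ 2 = a * d := by exact_mod_cast congrArg (Nat.cast : ℕ → ZMod b) hcd
    rw [← stdAddChar_crtRight h, he, mul_pow, hcd', mul_assoc]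

end

/-- The component modulo `2` is trivial, as `1` is the only unit modulo `2`. -/
theorem not_isPrimitive_two_mul {m : ℕ} [NeZero m] (hm : _root_.Odd m)
    (χ : DirichletCharacter ℂ (2 * m)) :
    ¬ χ.IsPrimitive := by
  intro hχ
  have h : Nat.Coprime 2 m := Nat.coprime_two_left.mpr hm
  refine (hχ.crtLeft h).ne_one (by norm_num) (MulChar.ext fun u => ?_)
  have hu : ∀ u : (ZMod 2)ˣ, u = 1 := by decide
  simp [hu u]

theorem gaussSum_of_level_four_mul {m : ℕ} [NeZero m] (hm : _root_.Odd m)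
    {χ : DirichletCharacter ℂ (4 * m)}
    (hχ : χ.IsQuadratic) (hχp : χ.IsPrimitive) (hodd : χ (-1) = -1) :
    gaussSum χ stdAddChar = I * Real.sqrt (4 * m : ℕ) := by
  have h2 : Nat.Coprime 2 m := Nat.coprime_two_left.mpr hm
  have h : Nat.Coprime 4 m := Nat.Coprime.pow_left 2 h2
  have hpar := crtLeft_neg_one_mul_crtRight_neg_one h χ
  have hL : crtLeft h χ 3 = -1 := by
    rcases hχ.crtLeft h 3 with h3 | h3 | h3
    · exact absurd h3 (MulChar.apply_ne_zero_iff.mpr (by decide))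
    · refine absurd (MulChar.ext fun u => ?_) ((hχp.crtLeft h).ne_one (by norm_num))
      have hu : ∀ u : (ZMod 4)ˣ, (u : ZMod 4) = 1 ∨ (u : ZMod 4) = 3 := by decide
      rw [MulChar.one_apply_coe]
      rcases hu u with hu | hu <;> simp [hu, h3]
    · exact h3
  have hmod : m % 4 = 1 := by
    by_contra hne
    rw [apply_neg_one_of_mod_four_eq_three (hχ.crtRight h) (hχp.crtRight h)
      (by rw [Nat.odd_iff] at hm; omega), hodd, show (-1 : ZMod 4) = 3 from rfl, hL] at hpar
    norm_num at hpar
  have hmz : (m : ZMod 4) = 1 := by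
    rw [← ZMod.natCast_mod, hmod, Nat.cast_one]
  rw [gaussSum_eq_sum_crtLeft_mul_sum_sq h hm hχ hχp h2 1 rfl (by rw [hmz, one_pow])]
  simp only [hmz, one_mul, Nat.cast_one]
  rw [sum_stdAddChar_sq_of_mod_four_eq_one hmod]
  have hsum : ∑ u : ZMod 4, crtLeft h χ u * stdAddChar u = 2 * I := by
    have h0 : crtLeft h χ 0 = 0 := MulChar.map_nonunit _ (by decide)
    have h2 : crtLeft h χ 2 = 0 := MulChar.map_nonunit _ (by decide)
    rw [ZMod.sum_eq_sum_range]
    simp only [Finset.sum_range_succ, Finset.sum_range_zero, stdAddChar_natCast]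
    have hI : cexp (2 * Real.pi * I / (4 : ℕ)) = I := by
      refine Eq.trans ?_ exp_pi_div_two_mul_I
      congr 1; push_cast; ring
    rw [hI]
    push_cast
    rw [h0, h2, hL, map_one, I_pow_three]
    ring
  rw [hsum]
  push_cast
  rw [Real.sqrt_mul (by norm_num), show (4 : ℝ) = 2 ^ 2 by norm_num, Real.sqrt_sq (by norm_num)]
  push_cast
  ring

theorem gaussSum_of_level_eight_mul {m : ℕ} [NeZero m] (hm : _root_.Odd m)
    {χ : DirichletCharacter ℂ (8 * m)}
    (hχ : χ.IsQuadratic) (hχp : χ.IsPrimitive) (hodd : χ (-1) = -1) :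
    gaussSum χ stdAddChar = I * Real.sqrt (8 * m : ℕ) := by
  have h2 : Nat.Coprime 2 m := Nat.coprime_two_left.mpr hm
  have h : Nat.Coprime 8 m := Nat.Coprime.pow_left 3 h2
  have hpar := crtLeft_neg_one_mul_crtRight_neg_one h χ
  have hL5 : crtLeft h χ 5 = -1 := by
    rcases hχ.crtLeft h 5 with h3 | h3 | h3
    · exact absurd h3 (MulChar.apply_ne_zero_iff.mpr (by decide))
    · refine absurd (hχp.crtLeft h) (not_isPrimitive_of_forall (d := 4) (by norm_num) (by norm_num)
        fun x _ hx => ?_)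
      have hx15 : x = 1 ∨ x = 5 := by
        revert hx x
        decide
      rcases hx15 with rfl | rfl
      · exact map_one _
      · exact h3
    · exact h3
  have hL7 : crtLeft h χ 7 = - crtLeft h χ 3 := by
    rw [show (7 : ZMod 8) = 5 * 3 from rfl, map_mul, hL5, neg_one_mul]
  have hm2 : m % 2 = 1 := Nat.odd_iff.mp hm
  have hI4 : I ^ m = I ^ (m % 4) := by
    conv_lhs => rw [← Nat.div_add_mod m 4, pow_add, pow_mul, I_pow_four, one_pow, one_mul]
  -- The parity of `χ` ties the component modulo `8` to the residue of `m` modulo `4`.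
  have hs : crtLeft h χ 3 * I ^ m = I := by
    rw [hodd, show (-1 : ZMod 8) = 7 from rfl, hL7] at hpar
    rcases (by omega : m % 4 = 1 ∨ m % 4 = 3) with hmod | hmod
    · rw [apply_neg_one_of_mod_four_eq_one (hχ.crtRight h) (hχp.crtRight h) hmod] at hpar
      rw [hI4, hmod]
      linear_combination -I * hpar
    · rw [apply_neg_one_of_mod_four_eq_three (hχ.crtRight h) (hχp.crtRight h) hmod] at hpar
      rw [hI4, hmod, I_pow_three]
      linear_combination -I * hpar
  have hm1 : (m : ZMod 8) ^ 2 = 1 := by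
    rw [← ZMod.natCast_mod]
    have : m % 8 = 1 ∨ m % 8 = 3 ∨ m % 8 = 5 ∨ m % 8 = 7 := by omega
    rcases this with h | h | h | h <;> rw [h] <;> decide
  rw [gaussSum_eq_sum_crtLeft_mul_sum_sq h hm hχ hχp (c := 4) (Nat.Coprime.pow_left 2 h2) 2 rfl hm1]
  rw [Nat.cast_ofNat, sum_stdAddChar_two_mul_sq hm]
  set ζ := cexp (Real.pi * I / 4) with hζ
  have hζ2 : ζ ^ 2 = I := exp_pi_mul_I_div_four_sq
  have hζinv : cexp (-Real.pi * I / 4) = ζ⁻¹ := by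
    rw [hζ, ← Complex.exp_neg]; congr 1; ring
  have hζ0 : ζ ≠ 0 := Complex.exp_ne_zero _
  have hsum : ∑ u : ZMod 8, crtLeft h χ u * stdAddChar (m * u : ZMod 8) = ζ ^ m * (2 + 2 * I) := by
    have h0 : crtLeft h χ 0 = 0 := MulChar.map_nonunit _ (by decide)
    have h2 : crtLeft h χ 2 = 0 := MulChar.map_nonunit _ (by decide)
    have h4 : crtLeft h χ 4 = 0 := MulChar.map_nonunit _ (by decide)
    have h6 : crtLeft h χ 6 = 0 := MulChar.map_nonunit _ (by decide)
    have h8 : cexp (2 * Real.pi * I / (8 : ℕ)) = ζ := by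
      rw [hζ]; congr 1; push_cast; ring
    rw [ZMod.sum_eq_sum_range]
    simp only [Finset.sum_range_succ, Finset.sum_range_zero, ← Nat.cast_mul, stdAddChar_natCast, h8,
      pow_mul]
    push_cast
    rw [h0, h2, h4, h6, hL5, hL7, map_one]
    have e2 : (ζ ^ m) ^ 2 = I ^ m := by rw [← pow_mul, mul_comm, pow_mul, hζ2]
    have e4 : (ζ ^ m) ^ 4 = -1 := by
      rw [show 4 = 2 * 2 from rfl, pow_mul, e2, ← pow_mul, mul_comm, pow_mul, I_sq, hm.neg_one_pow]
    linear_combination (-(ζ ^ m) - crtLeft h χ 3 * (ζ ^ m) ^ 3) * e4 +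
      2 * crtLeft h χ 3 * ζ ^ m * e2 + 2 * ζ ^ m * hs
  rw [hsum, hζinv]
  have hr2 : Real.sqrt 8 = 2 * Real.sqrt 2 := by
    rw [show (8 : ℝ) = 2 ^ 2 * 2 by norm_num, Real.sqrt_mul (by norm_num),
      Real.sqrt_sq (by norm_num)]
  push_cast
  rw [Real.sqrt_mul (by norm_num), hr2, inv_pow]
  have hζm : ζ ^ m ≠ 0 := pow_ne_zero _ hζ0
  field_simp
  push_cast
  linear_combination -2 * ζ * (Real.sqrt m : ℂ) * exp_pi_mul_I_div_four_mul_sqrt_two +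
    2 * (Real.sqrt m : ℂ) * (Real.sqrt 2 : ℂ) * hζ2

/-- The **sign of the quadratic Gauss sum** for real primitive odd characters of any level. -/
theorem gaussSum_eq_I_mul_sqrt {q : ℕ} [NeZero q] {χ : DirichletCharacter ℂ q}
    (hχ : χ.IsQuadratic) (hχp : χ.IsPrimitive) (hodd : χ (-1) = -1) :
    gaussSum χ stdAddChar = I * Real.sqrt q := by
  obtain ⟨k, m, hm, hq⟩ := Nat.exists_eq_two_pow_mul_odd (NeZero.ne q)
  have : NeZero m := ⟨by rintro rfl; simp at hm⟩
  rcases Nat.lt_or_ge k 4 with hk | hk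
  · interval_cases k
    · obtain rfl : q = m := by omega
      exact gaussSum_of_odd_level hχ hχp hm hodd
    · obtain rfl : q = 2 * m := by omega
      exact absurd hχp (not_isPrimitive_two_mul hm χ)
    · obtain rfl : q = 4 * m := by omega
      convert gaussSum_of_level_four_mul hm hχ hχp hodd
    · obtain rfl : q = 8 * m := by omega
      convert gaussSum_of_level_eight_mul hm hχ hχp hodd
  · subst hq
    have h : Nat.Coprime (2 ^ k) m := Nat.Coprime.pow_left k (Nat.coprime_two_left.mpr hm)
    exact absurd (hχp.crtLeft h) (not_isPrimitive_two_pow hk (hχ.crtLeft h))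

end DirichletCharacter

end

/-! ### The logarithmic series on the unit circle -/

section

open Complex ZMod

/-- Convergence follows from Dirichlet's test and the value from Abel's limit theorem. -/
theorem tendsto_sum_pow_div_neg_log {z : ℂ} (hz : ‖z‖ = 1) (hz1 : z ≠ 1) :
    Tendsto (fun N : ℕ => ∑ n ∈ Finset.range N, z ^ n / n) atTop (𝓝 (-log (1 - z))) := by
  have hz0 : 1 - z ≠ 0 := sub_ne_zero.mpr hz1.symm
  obtain ⟨l, hl⟩ : ∃ l, Tendsto (fun N : ℕ => ∑ n ∈ Finset.range N, z ^ n / n) atTop (𝓝 l) := by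
    have hanti : Antitone fun n : ℕ => 1 / ((n : ℝ) + 1) := fun a b hab => by
      simp only; gcongr
    have hb (n : ℕ) : ‖∑ i ∈ Finset.range n, z ^ (i + 1)‖ ≤ 2 / ‖1 - z‖ := by
      simp_rw [pow_succ]
      rw [← Finset.sum_mul, norm_mul, hz, mul_one, le_div_iff₀ (norm_pos_iff.mpr hz0), ← norm_mul,
        geom_sum_mul_neg]
      calc ‖1 - z ^ n‖ ≤ ‖(1 : ℂ)‖ + ‖z ^ n‖ := norm_sub_le _ _
        _ = 2 := by rw [norm_pow, hz]; norm_num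
    have hc := hanti.cauchySeq_series_mul_of_tendsto_zero_of_bounded
      tendsto_one_div_add_atTop_nhds_zero_nat hb
    obtain ⟨l, hl⟩ := cauchySeq_tendsto_of_complete hc
    refine ⟨l, (tendsto_add_atTop_iff_nat 1).mp (hl.congr fun n => ?_)⟩
    rw [Finset.sum_range_succ']
    simp only [Nat.cast_zero, div_zero, add_zero]
    refine Finset.sum_congr rfl fun i _ => ?_
    rw [real_smul]
    push_cast
    ring
  have habel := tendsto_tsum_powerSeries_nhdsWithin_lt hl
  rw [tendsto_map'_iff] at habel
  have hlog : Tendsto (fun r : ℝ => -log (1 - r * z)) (𝓝[<] 1) (𝓝 (-log (1 - z))) := by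
    have hslit : 1 - ((1 : ℝ) : ℂ) * z ∈ slitPlane := by
      refine Or.inl ?_
      rw [ofReal_one, one_mul, sub_re, one_re, sub_pos]
      refine lt_of_le_of_ne (hz ▸ re_le_norm z) fun h => hz1 ?_
      have h2 := Complex.sq_norm z
      rw [hz, normSq_apply, h] at h2
      exact Complex.ext h (by rw [one_im]; nlinarith)
    have : ContinuousAt (fun r : ℝ => -log (1 - r * z)) 1 :=
      (ContinuousAt.clog (f := fun r : ℝ => 1 - (r : ℂ) * z) (by fun_prop) hslit).neg
    have := this.tendsto
    rw [ofReal_one, one_mul] at this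
    exact tendsto_nhdsWithin_of_tendsto_nhds this
  have heq : ∀ᶠ r : ℝ in 𝓝[<] 1, ∑' n : ℕ, z ^ n / n * (r : ℂ) ^ n = -log (1 - r * z) := by
    filter_upwards [Ioo_mem_nhdsLT (show (0 : ℝ) < 1 by norm_num)] with r hr
    have hlt : ‖(r : ℂ) * z‖ < 1 := by
      rw [norm_mul, hz, mul_one, norm_real, Real.norm_of_nonneg hr.1.le]
      exact hr.2
    rw [← (hasSum_taylorSeries_neg_log hlt).tsum_eq]
    refine tsum_congr fun n => ?_
    rw [mul_pow]
    ring
  rwa [tendsto_nhds_unique (hlog.congr' (heq.mono fun _ h => h.symm)) habel]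

theorem log_one_sub_exp {x : ℝ} (h0 : 0 < x) (h1 : x < 1) :
    log (1 - cexp (2 * Real.pi * I * x)) =
      (Real.log (2 * Real.sin (Real.pi * x)) : ℂ) + Real.pi * I * (x - 1 / 2) := by
  have hpi := Real.pi_pos
  have hsin : 0 < Real.sin (Real.pi * x) :=
    Real.sin_pos_of_pos_of_lt_pi (by positivity) (by nlinarith)
  have key : 1 - cexp (2 * Real.pi * I * x) =
      ((2 * Real.sin (Real.pi * x) : ℝ) : ℂ) * cexp (Real.pi * I * (x - 1 / 2)) := by
    have e1 : cexp (2 * Real.pi * I * x) = cexp (Real.pi * x * I) ^ 2 := by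
      rw [← Complex.exp_nat_mul]; congr 1; push_cast; ring
    have e2 : cexp (Real.pi * I * (x - 1 / 2)) = cexp (Real.pi * x * I) * (-I) := by
      rw [show (Real.pi * I * (x - 1 / 2) : ℂ) = Real.pi * x * I + -(Real.pi / 2 * I) by ring,
        Complex.exp_add, Complex.exp_neg, exp_pi_div_two_mul_I, inv_I]
    have e3 := Complex.sin_sq_add_cos_sq (Real.pi * x)
    rw [e1, e2, exp_mul_I]
    push_cast
    linear_combination -e3 + (Complex.sin (Real.pi * x)) ^ 2 * I_sq
  rw [key, log_ofReal_mul (by positivity) (Complex.exp_ne_zero _)]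
  congr 1
  refine log_exp ?_ ?_
  · have : (Real.pi * I * (x - 1 / 2) : ℂ).im = Real.pi * (x - 1 / 2) := by
      simp
    rw [this]; nlinarith
  · have : (Real.pi * I * (x - 1 / 2) : ℂ).im = Real.pi * (x - 1 / 2) := by
      simp
    rw [this]; nlinarith

section
variable {q : ℕ} [NeZero q]

theorem DirichletCharacter.sum_mul_even_eq_zero {χ : DirichletCharacter ℂ q} (hodd : χ (-1) = -1)
    {g : ZMod q → ℂ} (hg : ∀ x, g (-x) = g x) : ∑ x, χ x * g x = 0 := by
  have h : ∑ x, χ x * g x = -∑ x, χ x * g x := by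
    rw [← Finset.sum_neg_distrib]
    refine (Equiv.sum_comp (Equiv.neg (ZMod q)) fun x => χ x * g x).symm.trans
      (Finset.sum_congr rfl fun x _ => ?_)
    rw [Equiv.neg_apply, hg, ← neg_one_mul x, map_mul, hodd]
    ring
  linear_combination h / 2

theorem DirichletCharacter.level_ne_one_of_odd {χ : DirichletCharacter ℂ q}
    (hodd : χ (-1) = -1) : q ≠ 1 := by
  rintro rfl
  rw [Subsingleton.elim (-1 : ZMod 1) 1, map_one] at hodd
  norm_num at hodd

theorem log_one_sub_stdAddChar {k : ZMod q} (hk : k ≠ 0) :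
    log (1 - stdAddChar k) = (Real.log (2 * Real.sin (Real.pi * (k.val / q : ℝ))) : ℂ) +
      Real.pi * I * ((k.val : ℂ) / q - 1 / 2) := by
  have hq : (0 : ℝ) < q := by exact_mod_cast NeZero.pos q
  have hv : 0 < k.val := Nat.pos_of_ne_zero ((ZMod.val_ne_zero k).mpr hk)
  have := log_one_sub_exp (x := k.val / q) (by positivity)
    ((div_lt_one hq).mpr (by exact_mod_cast k.val_lt))
  push_cast at this ⊢
  rw [← this]
  conv_lhs => rw [← ZMod.natCast_zmod_val k, stdAddChar_natCast, ← Complex.exp_nat_mul]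
  congr 3
  ring

theorem ZMod.val_neg_cast {k : ZMod q} (hk : k ≠ 0) : ((-k).val : ℝ) = q - k.val := by
  have : NeZero k := ⟨hk⟩
  rw [ZMod.val_neg_of_ne_zero, Nat.cast_sub k.val_lt.le]

/-- The even part of `log (1 - e(k/q))`, and the constant in its odd part, are annihilated by an odd
character. -/
theorem DirichletCharacter.sum_mul_log_one_sub {χ : DirichletCharacter ℂ q} (hodd : χ (-1) = -1) :
    ∑ k, χ k * log (1 - stdAddChar k) = Real.pi * I * ∑ k, χ k * ((k.val : ℂ) / q) := by
  have h0 : χ 0 = 0 := χ.map_zero' (level_ne_one_of_odd hodd)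
  have hq : (q : ℝ) ≠ 0 := NeZero.ne _
  have heven := sum_mul_even_eq_zero hodd
    (g := fun k => (Real.log (2 * Real.sin (Real.pi * (k.val / q : ℝ))) : ℂ) - Real.pi * I / 2)
    (fun k => by
      rcases eq_or_ne k 0 with rfl | hk
      · simp
      · rw [ZMod.val_neg_cast hk,
          show Real.pi * ((q - k.val : ℝ) / q) = Real.pi - Real.pi * (k.val / q) by
            field_simp, Real.sin_pi_sub])
  rw [Finset.mul_sum, ← sub_eq_zero, ← Finset.sum_sub_distrib, ← heven]
  refine Finset.sum_congr rfl fun k _ => ?_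
  rcases eq_or_ne k 0 with rfl | hk
  · simp [h0]
  · rw [log_one_sub_stdAddChar hk]
    ring

/-- `(k/q)² - k/q` is invariant under `k ↦ q - k`. -/
theorem DirichletCharacter.sum_mul_val_sq {χ : DirichletCharacter ℂ q} (hodd : χ (-1) = -1) :
    ∑ k, χ k * ((k.val : ℂ) / q) ^ 2 = ∑ k, χ k * ((k.val : ℂ) / q) := by
  have hq : (q : ℂ) ≠ 0 := NeZero.ne _
  rw [← sub_eq_zero, ← Finset.sum_sub_distrib, ← sum_mul_even_eq_zero hodd
    (g := fun k => ((k.val : ℂ) / q) ^ 2 - (k.val : ℂ) / q) (fun k => by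
      rcases eq_or_ne k 0 with rfl | hk
      · simp
      · have h := congrArg (fun x : ℝ => (x : ℂ)) (ZMod.val_neg_cast hk)
        push_cast at h
        rw [h]
        field_simp
        ring)]
  exact Finset.sum_congr rfl fun k _ => by ring

theorem DirichletCharacter.tendsto_sum_div {χ : DirichletCharacter ℂ q} (hχ : χ.IsQuadratic)
    (hχp : χ.IsPrimitive) (hodd : χ (-1) = -1) :
    Tendsto (fun N : ℕ => ∑ n ∈ Finset.range N, χ (n : ZMod q) / (n : ℂ)) atTop
      (𝓝 (-(Real.pi / Real.sqrt q) * ∑ k, χ k * ((k.val : ℂ) / q))) := by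
  have h0 : χ 0 = 0 := χ.map_zero' (level_ne_one_of_odd hodd)
  have hsq : (Real.sqrt q : ℂ) ≠ 0 := by
    exact_mod_cast (Real.sqrt_pos.mpr (by exact_mod_cast NeZero.pos q)).ne'
  have hτ := gaussSum_eq_I_mul_sqrt hχ hχp hodd
  have hexp (n : ZMod q) : χ n = (I * Real.sqrt q)⁻¹ * ∑ k, χ k * stdAddChar (n * k) := by
    have := gaussSum_mulShift_of_isPrimitive stdAddChar hχp n
    rw [hχ.inv, hτ, gaussSum] at this
    simp only [AddChar.mulShift_apply] at this
    rw [this, mul_comm (χ n), inv_mul_cancel_left₀ (mul_ne_zero I_ne_zero hsq)]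
  have hk (k : ZMod q) : Tendsto
      (fun N : ℕ => χ k * ∑ n ∈ Finset.range N, stdAddChar k ^ n / (n : ℂ))
      atTop (𝓝 (χ k * -log (1 - stdAddChar k))) := by
    rcases eq_or_ne k 0 with rfl | hk
    · simp [h0]
    · refine (tendsto_sum_pow_div_neg_log ?_ ?_).const_mul _
      · exact AddChar.norm_apply _ _
      · intro h
        exact hk (injective_stdAddChar (h.trans (AddChar.map_zero_eq_one _).symm))
  have hall := (tendsto_finsetSum Finset.univ fun k _ => hk k).const_mul (I * Real.sqrt q : ℂ)⁻¹
  simp only [mul_neg, Finset.sum_neg_distrib] at hall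
  rw [sum_mul_log_one_sub hodd] at hall
  convert hall using 1
  · ext N
    simp_rw [Finset.mul_sum]
    rw [Finset.sum_comm]
    refine Finset.sum_congr rfl fun n _ => ?_
    rw [hexp n, Finset.mul_sum, Finset.sum_div]
    refine Finset.sum_congr rfl fun k _ => ?_
    rw [← nsmul_eq_mul, AddChar.map_nsmul_eq_pow]
    ring
  · congr 1
    field_simp
end

end

/-! ### The value of the L-function at one -/

section

open MeasureTheory Complex

namespace DirichletCharacter

section
variable {q : ℕ} [NeZero q]

/-- The nonzero values of a Dirichlet character have modulus `1`. -/
theorem isQuadratic_of_im_eq_zero {χ : DirichletCharacter ℂ q} (h : ∀ a, (χ a).im = 0) :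
    χ.IsQuadratic := by
  intro a
  by_cases ha : IsUnit a
  · right
    have hn : ‖χ a‖ = 1 := by
      obtain ⟨u, rfl⟩ := ha
      exact χ.unit_norm_eq_one u
    have hre : χ a = ((χ a).re : ℂ) := Complex.ext rfl (by simp [h a])
    rw [hre, norm_real, Real.norm_eq_abs] at hn
    rw [hre]
    rcases (abs_eq zero_le_one).mp hn with h1 | h1 <;> rw [h1]
    · exact Or.inl ofReal_one
    · exact Or.inr (by simp)
  · exact Or.inl (χ.map_nonunit ha)

theorem norm_sum_range_le {χ : DirichletCharacter ℂ q} (hχ : χ ≠ 1) (n : ℕ) :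
    ‖∑ k ∈ Finset.range n, χ (k : ZMod q)‖ ≤ q := by
  have hper : Function.Periodic (fun n => ∑ k ∈ Finset.range n, χ (k : ZMod q)) q := by
    intro n
    have h0 : ∑ k ∈ Finset.range q, χ (k : ZMod q) = 0 := by
      rw [← ZMod.sum_eq_sum_range, χ.sum_eq_zero_of_ne_one hχ]
    simp only
    rw [add_comm, Finset.sum_range_add, h0, zero_add]
    refine Finset.sum_congr rfl fun k _ => ?_
    rw [Nat.cast_add, ZMod.natCast_self, zero_add]
  rw [← hper.map_mod_nat]
  calc _ ≤ ∑ k ∈ Finset.range (n % q), (1 : ℝ) := norm_sum_le_of_le _ fun k _ => χ.norm_le_one _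
    _ ≤ q := by
      rw [Finset.sum_const, Finset.card_range, nsmul_one]
      exact_mod_cast (Nat.mod_lt _ (NeZero.pos q)).le

theorem norm_sum_Icc_le {χ : DirichletCharacter ℂ q} (hχ : χ ≠ 1) (n : ℕ) :
    ‖∑ k ∈ Finset.Icc 0 n, χ (k : ZMod q)‖ ≤ q := by
  have := norm_sum_range_le hχ (n + 1)
  rwa [Nat.range_succ_eq_Icc_zero] at this

theorem sum_Icc_one_eq {q : ℕ} {χ : DirichletCharacter ℂ q} (h0 : χ 0 = 0) (f : ℕ → ℂ) (n : ℕ) :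
    ∑ k ∈ Finset.Icc 1 n, f k * χ (k : ZMod q) = ∑ k ∈ Finset.Icc 0 n, f k * χ (k : ZMod q) := by
  rw [← Finset.add_sum_Ioc_eq_sum_Icc (Nat.zero_le n)]
  simp only [Nat.cast_zero, h0, mul_zero, zero_add]
  rfl

theorem measurable_sum_Icc_floor (f : ℕ → ℂ) :
    Measurable fun t : ℝ => ∑ k ∈ Finset.Icc 0 ⌊t⌋₊, f k :=
  (measurable_from_nat (f := fun n => ∑ k ∈ Finset.Icc 0 n, f k)).comp Nat.measurable_floor

theorem LFunction_eq_mul_integral {χ : DirichletCharacter ℂ q} (hχ : χ ≠ 1) (h0 : χ 0 = 0)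
    {s : ℝ} (hs : 1 < s) :
    LFunction χ s = s * ∫ t in Set.Ioi (1 : ℝ),
      (∑ k ∈ Finset.Icc 0 ⌊t⌋₊, χ (k : ZMod q)) * (t : ℂ) ^ (-((s : ℂ) + 1)) := by
  have hs' : 1 < (s : ℂ).re := by simpa using hs
  rw [LFunction_eq_LSeries χ hs', LSeries_eq_mul_integral (fun n => χ (n : ZMod q)) le_rfl
    (s := s) (by rw [ofReal_re]; linarith) (χ.LSeriesSummable_of_one_lt_re hs')]
  · congr 2
    ext t
    congr 1
    simpa using sum_Icc_one_eq h0 (fun _ => 1) ⌊t⌋₊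
  · refine Asymptotics.IsBigO.of_bound q (Eventually.of_forall fun n => ?_)
    have := sum_Icc_one_eq h0 (fun _ => 1) n
    simp only [one_mul] at this
    rw [this]
    simpa using norm_sum_Icc_le hχ n

/-- The integral representation extends from `s > 1` to `s = 1` by dominated convergence. -/
theorem LFunction_one_eq_integral {χ : DirichletCharacter ℂ q} (hχ : χ ≠ 1) (h0 : χ 0 = 0) :
    LFunction χ 1 = ∫ t in Set.Ioi (1 : ℝ),
      (∑ k ∈ Finset.Icc 0 ⌊t⌋₊, χ (k : ZMod q)) * (t : ℂ) ^ (-2 : ℂ) := by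
  have hL : Tendsto (fun s : ℝ => LFunction χ s) (𝓝[>] 1) (𝓝 (LFunction χ 1)) := by
    have h1 : Continuous fun s : ℝ => LFunction χ s :=
      (differentiable_LFunction hχ).continuous.comp continuous_ofReal
    have := h1.tendsto 1
    rw [ofReal_one] at this
    exact tendsto_nhdsWithin_of_tendsto_nhds this
  have hint : Tendsto (fun s : ℝ => ∫ t in Set.Ioi (1 : ℝ),
      (∑ k ∈ Finset.Icc 0 ⌊t⌋₊, χ (k : ZMod q)) * (t : ℂ) ^ (-((s : ℂ) + 1))) (𝓝[>] 1)
      (𝓝 (∫ t in Set.Ioi (1 : ℝ),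
        (∑ k ∈ Finset.Icc 0 ⌊t⌋₊, χ (k : ZMod q)) * (t : ℂ) ^ (-2 : ℂ))) := by
    refine tendsto_integral_filter_of_dominated_convergence (fun t => q * t ^ (-2 : ℝ)) ?_ ?_ ?_ ?_
    · refine Eventually.of_forall fun s => Measurable.aestronglyMeasurable ?_
      exact (measurable_sum_Icc_floor _).mul (measurable_ofReal.pow_const _)
    · filter_upwards [self_mem_nhdsWithin] with s hs
      refine (ae_restrict_mem measurableSet_Ioi).mono fun t ht => ?_
      have ht' : (1 : ℝ) < t := ht
      have hs' : (1 : ℝ) < s := hs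
      rw [norm_mul, norm_cpow_eq_rpow_re_of_pos (by linarith)]
      refine mul_le_mul (norm_sum_Icc_le hχ _) ?_ (by positivity) (by positivity)
      refine Real.rpow_le_rpow_of_exponent_le ht'.le ?_
      rw [neg_re, add_re, ofReal_re, one_re]
      linarith
    · exact (integrableOn_Ioi_rpow_of_lt (by norm_num) one_pos).const_mul _
    · refine (ae_restrict_mem measurableSet_Ioi).mono fun t ht => ?_
      have ht' : (t : ℂ) ≠ 0 := by exact_mod_cast (zero_lt_one.trans ht).ne'
      refine Tendsto.const_mul _ ?_
      have : ContinuousAt (fun s : ℝ => (t : ℂ) ^ (-((s : ℂ) + 1))) 1 :=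
        ContinuousAt.const_cpow (by fun_prop) (Or.inl ht')
      have := this.tendsto
      rw [show (-(((1 : ℝ) : ℂ) + 1)) = (-2 : ℂ) by norm_num] at this
      exact tendsto_nhdsWithin_of_tendsto_nhds this
  have hs : Tendsto (fun s : ℝ => (s : ℂ)) (𝓝[>] 1) (𝓝 1) :=
    tendsto_nhdsWithin_of_tendsto_nhds (by simpa using continuous_ofReal.tendsto (1 : ℝ))
  have := hs.mul hint
  rw [one_mul] at this
  refine tendsto_nhds_unique hL (this.congr' ?_)
  filter_upwards [self_mem_nhdsWithin] with s hs
  exact (LFunction_eq_mul_integral hχ h0 hs).symm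

/-- Conditional convergence at `s = 1`, by Abel summation against the bounded partial sums of
`χ`. -/
theorem tendsto_sum_div_LFunction_one {χ : DirichletCharacter ℂ q} (hχ : χ ≠ 1) (h0 : χ 0 = 0) :
    Tendsto (fun N : ℕ => ∑ n ∈ Finset.Icc 1 N, χ (n : ZMod q) / (n : ℂ)) atTop
      (𝓝 (LFunction χ 1)) := by
  have hd (t : ℝ) (ht : t ∈ Set.Ici (1 : ℝ)) :
      HasDerivAt (fun t : ℝ => (t : ℂ)⁻¹) (-((t : ℂ) ^ 2)⁻¹) t := by
    have ht0 : (t : ℂ) ≠ 0 := by exact_mod_cast (zero_lt_one.trans_le ht).ne'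
    exact (hasDerivAt_inv ht0).comp_ofReal
  have hb (n : ℕ) := norm_sum_Icc_le hχ n
  have key := tendsto_sum_mul_atTop_nhds_one_sub_integral₀ (fun n => χ (n : ZMod q))
    (f := fun t : ℝ => (t : ℂ)⁻¹) (l := 0) (g := fun t => t ^ (-2 : ℝ)) (by simpa using h0)
    (fun t ht => (hd t ht).differentiableAt) ?_ ?_ ?_ ?_
  · rw [zero_sub, ← integral_neg] at key
    rw [LFunction_one_eq_integral hχ h0]
    convert key using 1
    · ext N
      simpa [div_eq_inv_mul] using sum_Icc_one_eq h0 (fun n => (n : ℂ)⁻¹) N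
    · congr 1
      refine setIntegral_congr_fun measurableSet_Ioi fun t ht => ?_
      rw [(hd t (Set.mem_Ici.mpr (le_of_lt ht))).deriv,
        show (-2 : ℂ) = ((-2 : ℤ) : ℂ) by norm_num, cpow_intCast, zpow_neg, zpow_ofNat]
      ring
  · refine ContinuousOn.locallyIntegrableOn (ContinuousOn.congr (f := fun t : ℝ => -((t : ℂ) ^ 2)⁻¹)
      (fun t ht => ContinuousAt.continuousWithinAt ?_) fun t ht => (hd t ht).deriv)
      measurableSet_Ici
    have ht0 : (t : ℂ) ≠ 0 := by exact_mod_cast (zero_lt_one.trans_le ht).ne'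
    exact (ContinuousAt.inv₀ (f := fun t : ℝ => (t : ℂ) ^ 2) (by fun_prop) (pow_ne_zero 2 ht0)).neg
  · refine squeeze_zero_norm (a := fun n : ℕ => (q : ℝ) / n) (fun n => ?_)
      (tendsto_const_div_atTop_nhds_zero_nat _)
    rw [norm_mul, norm_inv, norm_real, Real.norm_natCast, div_eq_inv_mul]
    gcongr
    exact hb n
  · refine Asymptotics.IsBigO.of_bound q ?_
    filter_upwards [eventually_ge_atTop 1] with t ht
    rw [(hd t ht).deriv, norm_mul, norm_neg, norm_inv, norm_pow, norm_real, mul_comm,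
      Real.norm_of_nonneg (Real.rpow_nonneg (zero_le_one.trans ht) _),
      Real.norm_of_nonneg (zero_le_one.trans ht),
      Real.rpow_neg (zero_le_one.trans ht), Real.rpow_ofNat]
    gcongr
    exact hb _
  · exact ⟨Set.Ioi 1, Ioi_mem_atTop 1, integrableOn_Ioi_rpow_of_lt (by norm_num) one_pos⟩

end

end DirichletCharacter

end

/-! ### The identity -/

open DirichletCharacter in
theorem mainTheorem3 (q : ℕ) [NeZero q] (χ : DirichletCharacter ℂ q)
    (hprim : χ.IsPrimitive)
    (hreal : ∀ a : ZMod q, (χ a).im = 0)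
    (hodd : χ (-1) = -1) :
    Tendsto (fun N : ℕ => ∑ n ∈ Finset.Icc 1 N, χ (n : ZMod q) / (n : ℂ)) atTop
        (𝓝 (DirichletCharacter.LFunction χ 1)) ∧
      ∑ k ∈ Finset.Ico 1 q, χ (k : ZMod q) * ((k : ℂ) / (q : ℂ)) ^ 2 =
        -(((Real.sqrt (q : ℝ) / Real.pi : ℝ) : ℂ)) * DirichletCharacter.LFunction χ 1 := by
  have hq1 : q ≠ 1 := level_ne_one_of_odd hodd
  have h0 : χ 0 = 0 := χ.map_zero' hq1
  have hquad : χ.IsQuadratic := isQuadratic_of_im_eq_zero hreal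
  have hlim := tendsto_sum_div_LFunction_one (hprim.ne_one hq1) h0
  refine ⟨hlim, ?_⟩
  have hlim' := (tendsto_sum_div hquad hprim hodd).comp (tendsto_add_atTop_nat 1)
  have hL : LFunction χ 1 = -(Real.pi / Real.sqrt q) * ∑ k, χ k * ((k.val : ℂ) / q) := by
    refine tendsto_nhds_unique hlim (hlim'.congr fun N => ?_)
    have := sum_Icc_one_eq h0 (fun n => (n : ℂ)⁻¹) N
    simp only [← div_eq_inv_mul] at this
    rw [this, Function.comp_apply, Nat.range_succ_eq_Icc_zero]
  have hsum : ∑ k ∈ Finset.Ico 1 q, χ (k : ZMod q) * ((k : ℂ) / (q : ℂ)) ^ 2 =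
      ∑ k, χ k * ((k.val : ℂ) / q) ^ 2 := by
    rw [ZMod.sum_eq_sum_range, Finset.range_eq_Ico, Finset.sum_eq_sum_Ico_succ_bot (NeZero.pos q),
      Nat.cast_zero, h0, zero_mul, zero_add]
    refine Finset.sum_congr rfl fun k hk => ?_
    rw [ZMod.val_cast_of_lt (Finset.mem_Ico.mp hk).2]
  have hs : (Real.sqrt q : ℂ) ≠ 0 := by
    exact_mod_cast (Real.sqrt_pos.mpr (by exact_mod_cast NeZero.pos q)).ne'
  have hpi : (Real.pi : ℂ) ≠ 0 := by exact_mod_cast Real.pi_ne_zero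
  rw [hsum, sum_mul_val_sq hodd, hL]
  push_cast
  field_simp
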